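/- **Weak quantum de Finetti theorem.** Let $\mathfrak H$ be a separable complex Hilbert space. For $n\ge 0$ let $\mathfrak H^n=\bigotimes_{\rm sym}^n\mathfrak H$ be the symmetric subspace of the Hilbert space tensor power $\mathfrak H^{\otimes n}$ (with $\mathfrak H^0=\mathbb C$), and let $\mathfrak S^1(\mathfrak H^n)$ denote the trace class operators on $\mathfrak H^n$. Let $(\Gamma_N)_{N\in\mathbb N}$ be a sequence of bosonic states, i.e. $\Gamma_N\in\mathfrak S^1(\mathfrak H^N)$ is positive (in particular self-adjoint) with $\operatorname{Tr}\Gamma_N=1$. For $N\ge k$ let $\gamma_N^{(k)}=\operatorname{Tr}_{k+1\to N}[\Gamma_N]$, an operator on $\mathfrak H^k$, be its $k$-body reduced density matrix, that is, the partial trace of $\Gamma_N$ over $N-k$ of the $N$ tensor factors (so $\operatorname{Tr}\gamma_N^{(k)}=1$). Assume that for every $k\in\mathbb N$ there is $\gamma^{(k)}\in\mathfrak S^1(\mathfrak H^k)$ such that $$\gamma_N^{(k)}\rightharpoonup_*\gamma^{(k)}\quad\text{in }\mathfrak S^1(\mathfrak H^k)\text{ as }N\to\infty,$$ i.e. $\operatorname{Tr}[\gamma_N^{(k)}K]\to\operatorname{Tr}[\gamma^{(k)}K]$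 for every compact operator $K$ on $\mathfrak H^k$. Then there exists a unique Borel probability measure $\mu$ on the unit ball $B\mathfrak H=\{u\in\mathfrak H:\|u\|\le 1\}$, invariant under the action $u\mapsto e^{i\theta}u$ of $S^1$, such that $$\gamma^{(k)}=\int_{B\mathfrak H}|u^{\otimes k}\rangle\langle u^{\otimes k}|\,d\mu(u)\qquad\text{for all }k\ge 0 .$$ -/

import Mathlib

open Filter Topology MeasureTheory
open scoped TensorProduct InnerProductSpace ComplexConjugate

noncomputable section

namespace DeFinetti

/-! ### Hilbert tensor powers -/

/-- The algebraic tensor power `H ⊗ ⋯ ⊗ H` (`n` factors). It is a type synonym of Mathlib's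
`⨂[ℂ] _ : Fin n, H`, because the latter carries the injective seminorm, whereas here we use
the Hilbert space inner product. -/
def AlgTensorPower (H : Type*) [NormedAddCommGroup H] [InnerProductSpace ℂ H] (n : ℕ) : Type _ :=
  ⨂[ℂ] _ : Fin n, H

section Algebraic

variable {H : Type*} [NormedAddCommGroup H] [InnerProductSpace ℂ H] {n : ℕ}

instance : AddCommGroup (AlgTensorPower H n) :=
  inferInstanceAs (AddCommGroup (⨂[ℂ] _ : Fin n, H))

instance : Module ℂ (AlgTensorPower H n) :=
  inferInstanceAs (Module ℂ (⨂[ℂ] _ : Fin n, H))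

/-- The pure tensor `v₁ ⊗ ⋯ ⊗ vₙ`. -/
def algTprod (v : Fin n → H) : AlgTensorPower H n := PiTensorProduct.tprod ℂ v

/-- The linear functional `y ↦ ⟨v₁ ⊗ ⋯ ⊗ vₙ, y⟩`. -/
def pairing (v : Fin n → H) : AlgTensorPower H n →ₗ[ℂ] ℂ :=
  PiTensorProduct.lift
    ((MultilinearMap.mkPiAlgebra ℂ (Fin n) ℂ).compLinearMap fun i => innerₛₗ ℂ (v i))

theorem pairing_algTprod (v w : Fin n → H) :
    pairing v (algTprod w) = ∏ i, ⟪v i, w i⟫_ℂ := by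
  unfold pairing algTprod
  erw [PiTensorProduct.lift.tprod]
  simp

theorem algTensor_ext {E : Type*} [AddCommMonoid E] [Module ℂ E]
    {f g : AlgTensorPower H n →ₗ[ℂ] E} (h : ∀ v, f (algTprod v) = g (algTprod v)) : f = g :=
  PiTensorProduct.ext (R := ℂ) (s := fun _ : Fin n => H) (MultilinearMap.ext h)

theorem prod_update_add (v w : Fin n → H) (i : Fin n) (a b : H) :
    ∏ j, ⟪Function.update v i (a + b) j, w j⟫_ℂ
      = ∏ j, ⟪Function.update v i a j, w j⟫_ℂ + ∏ j, ⟪Function.update v i b j, w j⟫_ℂ := by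
  have key : ∀ c : H, ∏ j, ⟪Function.update v i c j, w j⟫_ℂ
      = ⟪c, w i⟫_ℂ * ∏ j ∈ Finset.univ.erase i, ⟪v j, w j⟫_ℂ := by
    intro c
    rw [← Finset.mul_prod_erase _ _ (Finset.mem_univ i)]
    congr 1
    · simp
    · refine Finset.prod_congr rfl fun j hj => ?_
      rw [Function.update_of_ne (Finset.ne_of_mem_erase hj)]
  rw [key, key, key, inner_add_left, add_mul]

theorem prod_update_smul (v w : Fin n → H) (i : Fin n) (c : ℂ) (a : H) :
    ∏ j, ⟪Function.update v i (c • a) j, w j⟫_ℂ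
      = conj c * ∏ j, ⟪Function.update v i a j, w j⟫_ℂ := by
  have key : ∀ c : H, ∏ j, ⟪Function.update v i c j, w j⟫_ℂ
      = ⟪c, w i⟫_ℂ * ∏ j ∈ Finset.univ.erase i, ⟪v j, w j⟫_ℂ := by
    intro c
    rw [← Finset.mul_prod_erase _ _ (Finset.mem_univ i)]
    congr 1
    · simp
    · refine Finset.prod_congr rfl fun j hj => ?_
      rw [Function.update_of_ne (Finset.ne_of_mem_erase hj)]
  rw [key, key, inner_smul_left, mul_assoc]

theorem pairing_update_add (v : Fin n → H) (i : Fin n) (a b : H) :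
    pairing (Function.update v i (a + b))
      = pairing (Function.update v i a) + pairing (Function.update v i b) :=
  algTensor_ext fun w => by
    simp only [LinearMap.add_apply, pairing_algTprod, prod_update_add]

theorem pairing_update_smul (v : Fin n → H) (i : Fin n) (c : ℂ) (a : H) :
    pairing (Function.update v i (c • a)) = conj c • pairing (Function.update v i a) :=
  algTensor_ext fun w => by
    simp only [LinearMap.smul_apply, pairing_algTprod, prod_update_smul, smul_eq_mul]

/-- The linear functional `x ↦ ⟨y, x⟩`, defined on pure tensors `x = v₁ ⊗ ⋯ ⊗ vₙ` as the
complex conjugate of `⟨v₁ ⊗ ⋯ ⊗ vₙ, y⟩`. -/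
def conjPairing (y : AlgTensorPower H n) : AlgTensorPower H n →ₗ[ℂ] ℂ :=
  PiTensorProduct.lift
    { toFun := fun v => conj (pairing v y)
      map_update_add' := by
        intro inst v i a b
        obtain rfl : inst = instDecidableEqFin n := Subsingleton.elim _ _
        rw [pairing_update_add, LinearMap.add_apply, map_add]
      map_update_smul' := by
        intro inst v i c a
        obtain rfl : inst = instDecidableEqFin n := Subsingleton.elim _ _
        rw [pairing_update_smul, LinearMap.smul_apply, smul_eq_mul, map_mul, Complex.conj_conj,
          smul_eq_mul] }

theorem conjPairing_algTprod (y : AlgTensorPower H n) (v : Fin n → H) :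
    conjPairing y (algTprod v) = conj (pairing v y) := by
  unfold conjPairing algTprod
  erw [PiTensorProduct.lift.tprod]
  rfl

theorem conjPairing_add (y z : AlgTensorPower H n) :
    conjPairing (y + z) = conjPairing y + conjPairing z :=
  algTensor_ext fun v => by
    simp only [LinearMap.add_apply, conjPairing_algTprod, map_add]

theorem conjPairing_smul (c : ℂ) (y : AlgTensorPower H n) :
    conjPairing (c • y) = conj c • conjPairing y :=
  algTensor_ext fun v => by
    simp only [LinearMap.smul_apply, conjPairing_algTprod, map_smul, smul_eq_mul, map_mul]

/-- The sesquilinear form on the algebraic tensor power (conjugate linear on the left) with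
`⟨v₁ ⊗ ⋯ ⊗ vₙ, w₁ ⊗ ⋯ ⊗ wₙ⟩ = ∏ᵢ ⟨vᵢ, wᵢ⟩`. -/
def form : AlgTensorPower H n →ₗ⋆[ℂ] AlgTensorPower H n →ₗ[ℂ] ℂ where
  toFun := conjPairing
  map_add' := conjPairing_add
  map_smul' := conjPairing_smul

theorem form_algTprod (v w : Fin n → H) :
    form (algTprod v) (algTprod w) = ∏ i, ⟪v i, w i⟫_ℂ := by
  change conjPairing (algTprod v) (algTprod w) = _
  rw [conjPairing_algTprod, pairing_algTprod, map_prod]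
  exact Finset.prod_congr rfl fun i _ => inner_conj_symm _ _

theorem exists_sum_algTprod (x : AlgTensorPower H n) :
    ∃ c : (Fin n → H) →₀ ℂ, x = c.sum fun v a => a • algTprod v := by
  have hx : x ∈ Submodule.span ℂ (Set.range (algTprod (H := H) (n := n))) := by
    have := PiTensorProduct.span_tprod_eq_top (R := ℂ) (s := fun _ : Fin n => H)
    exact (this ▸ Submodule.mem_top : (x : ⨂[ℂ] _ : Fin n, H) ∈ _)
  obtain ⟨c, hc⟩ := Finsupp.mem_span_range_iff_exists_finsupp.mp hx
  exact ⟨c, hc.symm⟩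

theorem form_sum (c d : (Fin n → H) →₀ ℂ) :
    form (c.sum fun v a => a • algTprod v) (d.sum fun w b => b • algTprod w)
      = c.sum fun v a => d.sum fun w b => star a * (∏ i, ⟪v i, w i⟫_ℂ) * b := by
  simp only [Finsupp.sum, map_sum, LinearMap.sum_apply, map_smulₛₗ, LinearMap.smul_apply,
    form_algTprod, smul_eq_mul, RingHom.id_apply, Complex.star_def]
  simp only [Finset.mul_sum]
  rw [Finset.sum_comm]
  exact Finset.sum_congr rfl fun v _ => Finset.sum_congr rfl fun w _ => by ring

open scoped ComplexOrder in
theorem posSemidef_inner (H : Type*) [NormedAddCommGroup H] [InnerProductSpace ℂ H]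
    {X : Type*} (f : X → H) :
    (Matrix.of fun v w : X => ⟪f v, f w⟫_ℂ).PosSemidef := by
  refine ⟨Matrix.ext fun v w => inner_conj_symm _ _, fun c => ?_⟩
  have : (c.sum fun v a => c.sum fun w b =>
      star a * (Matrix.of fun v w : X => ⟪f v, f w⟫_ℂ) v w * b)
      = ⟪c.sum fun v a => a • f v, c.sum fun v a => a • f v⟫_ℂ := by
    simp only [Finsupp.sum, sum_inner, inner_sum, inner_smul_left, inner_smul_right,
      Matrix.of_apply, Complex.star_def, Finset.mul_sum]
    rw [Finset.sum_comm]
    exact Finset.sum_congr rfl fun v _ => Finset.sum_congr rfl fun w _ => by ring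
  rw [this, inner_self_eq_norm_sq_to_K, ← RCLike.ofReal_pow]
  exact Complex.zero_le_real.mpr (sq_nonneg _)

open scoped ComplexOrder in
theorem posSemidef_prod (s : Finset (Fin n)) :
    (Matrix.of fun v w : Fin n → H => ∏ i ∈ s, ⟪v i, w i⟫_ℂ).PosSemidef := by
  classical
  induction s using Finset.induction_on with
  | empty => simpa using posSemidef_inner ℂ (fun _ : Fin n → H => (1 : ℂ))
  | insert i s hi ih =>
    have h := (posSemidef_inner H (fun v : Fin n → H => v i)).hadamard ih
    have e : (Matrix.of fun v w : Fin n → H => ∏ j ∈ insert i s, ⟪v j, w j⟫_ℂ)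
        = (Matrix.of fun v w : Fin n → H => ⟪v i, w i⟫_ℂ).hadamard
          (Matrix.of fun v w : Fin n → H => ∏ j ∈ s, ⟪v j, w j⟫_ℂ) := by
      ext v w
      exact Finset.prod_insert hi
    rw [e]
    exact h

/-- The inner product on the algebraic tensor power. -/
@[reducible] def preCore : PreInnerProductSpace.Core ℂ (AlgTensorPower H n) where
  inner x y := form x y
  conj_inner_symm x y := by
    obtain ⟨c, rfl⟩ := exists_sum_algTprod x
    obtain ⟨d, rfl⟩ := exists_sum_algTprod y
    rw [form_sum, form_sum]
    simp only [Finsupp.sum, map_sum, map_mul, map_prod, inner_conj_symm, Complex.star_def,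
      Complex.conj_conj]
    rw [Finset.sum_comm]
    exact Finset.sum_congr rfl fun v _ => Finset.sum_congr rfl fun w _ => by ring
  re_inner_nonneg x := by
    obtain ⟨c, rfl⟩ := exists_sum_algTprod x
    rw [form_sum]
    exact (Complex.le_def.mp ((posSemidef_prod Finset.univ).2 c)).1
  add_left x y z := by simp
  smul_left x y r := by simp

instance : SeminormedAddCommGroup (AlgTensorPower H n) :=
  @InnerProductSpace.Core.toSeminormedAddCommGroup ℂ _ _ _ _ preCore

instance : InnerProductSpace ℂ (AlgTensorPower H n) := InnerProductSpace.ofCore preCore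

theorem inner_algTprod (v w : Fin n → H) :
    ⟪algTprod v, algTprod w⟫_ℂ = ∏ i, ⟪v i, w i⟫_ℂ := form_algTprod v w

theorem inner_eq_of_algTprod {m : ℕ} (f : AlgTensorPower H n →ₗ[ℂ] AlgTensorPower H m) (c : ℂ)
    (h : ∀ v w, ⟪f (algTprod v), f (algTprod w)⟫_ℂ = c * ⟪algTprod v, algTprod w⟫_ℂ)
    (x y : AlgTensorPower H n) : ⟪f x, f y⟫_ℂ = c * ⟪x, y⟫_ℂ := by
  obtain ⟨a, rfl⟩ := exists_sum_algTprod x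
  obtain ⟨b, rfl⟩ := exists_sum_algTprod y
  simp only [Finsupp.sum, map_sum, map_smul, sum_inner, inner_sum, inner_smul_left,
    inner_smul_right, h, Finset.mul_sum]
  exact Finset.sum_congr rfl fun v _ => Finset.sum_congr rfl fun w _ => by ring

/-- Permutation of the tensor factors on the algebraic tensor power. -/
def algPermute (σ : Equiv.Perm (Fin n)) : AlgTensorPower H n →ₗ[ℂ] AlgTensorPower H n :=
  (PiTensorProduct.reindex ℂ (fun _ : Fin n => H) σ).toLinearMap

theorem algPermute_algTprod (σ : Equiv.Perm (Fin n)) (v : Fin n → H) :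
    algPermute σ (algTprod v) = algTprod fun i => v (σ.symm i) :=
  PiTensorProduct.reindex_tprod σ v

/-- The linear map `x ↦ x ⊗ v₁ ⊗ ⋯ ⊗ vₘ` on the algebraic tensor power. -/
def algAppend (k : ℕ) {m : ℕ} (v : Fin m → H) :
    AlgTensorPower H k →ₗ[ℂ] AlgTensorPower H (k + m) :=
  (TensorPower.mulEquiv (R := ℂ) (M := H) (n := k) (m := m)).toLinearMap ∘ₗ
    (TensorProduct.mk ℂ (⨂[ℂ]^k H) (⨂[ℂ]^m H)).flip (PiTensorProduct.tprod ℂ v)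

theorem algAppend_algTprod (k : ℕ) {m : ℕ} (w : Fin k → H) (v : Fin m → H) :
    algAppend k v (algTprod w) = algTprod (Fin.append w v) :=
  TensorPower.tprod_mul_tprod ℂ w v

theorem norm_algPermute (σ : Equiv.Perm (Fin n)) (x : AlgTensorPower H n) :
    ‖algPermute σ x‖ ≤ 1 * ‖x‖ := by
  have h := inner_eq_of_algTprod (algPermute σ) 1 (fun v w => by
    rw [algPermute_algTprod, algPermute_algTprod, inner_algTprod, inner_algTprod, one_mul]
    exact Equiv.prod_comp σ.symm fun i => ⟪v i, w i⟫_ℂ) x x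
  rw [one_mul] at h ⊢
  rw [@norm_eq_sqrt_re_inner ℂ, @norm_eq_sqrt_re_inner ℂ _ _ _ _ x, h]

theorem norm_algAppend (k : ℕ) {m : ℕ} (v : Fin m → H) (x : AlgTensorPower H k) :
    ‖algAppend k v x‖ ≤ (∏ i, ‖v i‖) * ‖x‖ := by
  have h := inner_eq_of_algTprod (algAppend k v) (((∏ i, ‖v i‖) ^ 2 : ℝ) : ℂ) (fun w w' => by
    rw [algAppend_algTprod, algAppend_algTprod, inner_algTprod, inner_algTprod,
      Fin.prod_univ_add, mul_comm]
    simp only [Fin.append_left, Fin.append_right, inner_self_eq_norm_sq_to_K]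
    simp [Finset.prod_pow]) x x
  have h0 : 0 ≤ ∏ i, ‖v i‖ := Finset.prod_nonneg fun i _ => norm_nonneg _
  rw [@norm_eq_sqrt_re_inner ℂ, @norm_eq_sqrt_re_inner ℂ _ _ _ _ x, h]
  have : RCLike.re ((((∏ i, ‖v i‖) ^ 2 : ℝ) : ℂ) * ⟪x, x⟫_ℂ)
      = (∏ i, ‖v i‖) ^ 2 * RCLike.re ⟪x, x⟫_ℂ := Complex.re_ofReal_mul _ _
  rw [this, Real.sqrt_mul (sq_nonneg _), Real.sqrt_sq h0]

end Algebraic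

/-- The Hilbert tensor power of `H` (`n` factors): the Hilbert space completion of the algebraic
tensor power. -/
def TensorPow (H : Type*) [NormedAddCommGroup H] [InnerProductSpace ℂ H] (n : ℕ) : Type _ :=
  UniformSpace.Completion (AlgTensorPower H n)

section Hilbert

variable {H : Type*} [NormedAddCommGroup H] [InnerProductSpace ℂ H]

instance (n : ℕ) : NormedAddCommGroup (TensorPow H n) :=
  inferInstanceAs (NormedAddCommGroup (UniformSpace.Completion (AlgTensorPower H n)))

instance (n : ℕ) : InnerProductSpace ℂ (TensorPow H n) :=
  inferInstanceAs (InnerProductSpace ℂ (UniformSpace.Completion (AlgTensorPower H n)))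

instance (n : ℕ) : CompleteSpace (TensorPow H n) :=
  inferInstanceAs (CompleteSpace (UniformSpace.Completion (AlgTensorPower H n)))

/-- The pure tensor `v₁ ⊗ ⋯ ⊗ vₙ` in the Hilbert tensor power. -/
def tprod {n : ℕ} (v : Fin n → H) : TensorPow H n :=
  ((algTprod v : AlgTensorPower H n) : UniformSpace.Completion (AlgTensorPower H n))

theorem inner_tprod {n : ℕ} (v w : Fin n → H) :
    ⟪tprod v, tprod w⟫_ℂ = ∏ i, ⟪v i, w i⟫_ℂ :=
  (UniformSpace.Completion.inner_coe _ _).trans (inner_algTprod v w)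

/-- The operator permuting the tensor factors,
`v₁ ⊗ ⋯ ⊗ vₙ ↦ v_{σ⁻¹(1)} ⊗ ⋯ ⊗ v_{σ⁻¹(n)}`. -/
def permute {n : ℕ} (σ : Equiv.Perm (Fin n)) : TensorPow H n →L[ℂ] TensorPow H n :=
  ((algPermute σ).mkContinuous 1 (norm_algPermute σ)).completion

theorem permute_tprod {n : ℕ} (σ : Equiv.Perm (Fin n)) (v : Fin n → H) :
    permute σ (tprod v) = tprod fun i => v (σ.symm i) :=
  (ContinuousLinearMap.completion_apply_coe _ _).trans
    (congrArg _ (algPermute_algTprod σ v))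

/-- The operator `x ↦ x ⊗ v₁ ⊗ ⋯ ⊗ vₘ` between Hilbert tensor powers. -/
def append (k : ℕ) {m : ℕ} (v : Fin m → H) : TensorPow H k →L[ℂ] TensorPow H (k + m) :=
  ((algAppend k v).mkContinuous (∏ i, ‖v i‖) (norm_algAppend k v)).completion

theorem append_tprod (k : ℕ) {m : ℕ} (w : Fin k → H) (v : Fin m → H) :
    append k v (tprod w) = tprod (Fin.append w v) :=
  (ContinuousLinearMap.completion_apply_coe _ _).trans
    (congrArg _ (algAppend_algTprod k w v))

/-- The symmetric (bosonic) subspace of the Hilbert tensor power. -/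
def symSubspace (H : Type*) [NormedAddCommGroup H] [InnerProductSpace ℂ H] (n : ℕ) :
    Submodule ℂ (TensorPow H n) where
  carrier := {x | ∀ σ : Equiv.Perm (Fin n), permute σ x = x}
  add_mem' hx hy σ := by rw [map_add, hx σ, hy σ]
  zero_mem' σ := map_zero _
  smul_mem' c x hx σ := by rw [map_smul, hx σ]

theorem isClosed_symSubspace (H : Type*) [NormedAddCommGroup H] [InnerProductSpace ℂ H] (n : ℕ) :
    IsClosed (symSubspace H n : Set (TensorPow H n)) := by
  have : (symSubspace H n : Set (TensorPow H n))
      = ⋂ σ : Equiv.Perm (Fin n), {x | permute σ x = x} := by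
    ext x; simp [symSubspace]
  rw [this]
  exact isClosed_iInter fun σ => isClosed_eq (permute σ).continuous continuous_id

/-- The bosonic `n`-particle Hilbert space `⨂_sym^n H`, with the inner product of the tensor
power. -/
def SymPow (H : Type*) [NormedAddCommGroup H] [InnerProductSpace ℂ H] (n : ℕ) : Type _ :=
  symSubspace H n

instance (n : ℕ) : NormedAddCommGroup (SymPow H n) :=
  inferInstanceAs (NormedAddCommGroup (symSubspace H n))

instance (n : ℕ) : InnerProductSpace ℂ (SymPow H n) :=
  inferInstanceAs (InnerProductSpace ℂ (symSubspace H n))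

instance (n : ℕ) : CompleteSpace (SymPow H n) :=
  (isClosed_symSubspace H n).completeSpace_coe

/-- The isometric inclusion of the bosonic `n`-particle space into the full tensor power. -/
def symIncl (H : Type*) [NormedAddCommGroup H] [InnerProductSpace ℂ H] (n : ℕ) :
    SymPow H n →L[ℂ] TensorPow H n :=
  (symSubspace H n).subtypeL

/-- The vector `u^{⊗ n} = u ⊗ ⋯ ⊗ u` of the bosonic `n`-particle space. -/
def powTensor (u : H) (n : ℕ) : SymPow H n :=
  (⟨tprod fun _ => u, fun σ => permute_tprod σ _⟩ : symSubspace H n)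

end Hilbert

/-! ### Trace class operators -/

section TraceClass

variable {E : Type*} [NormedAddCommGroup E] [InnerProductSpace ℂ E] [CompleteSpace E]

/-- The index set of `someBasis`. -/
def basisIndex (E : Type*) [NormedAddCommGroup E] [InnerProductSpace ℂ E] [CompleteSpace E] :
    Set E :=
  (exists_hilbertBasis ℂ E).choose

/-- Some orthonormal basis of the Hilbert space `E`. The notions below do not depend on this
choice. -/
def someBasis (E : Type*) [NormedAddCommGroup E] [InnerProductSpace ℂ E] [CompleteSpace E] :
    HilbertBasis (basisIndex E) ℂ E :=
  (exists_hilbertBasis ℂ E).choose_spec.choose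

/-- `T` is trace class: `Tr |T| < ∞`, where `|T| = (T* T)^{1/2}`. -/
def IsTraceClass (T : E →L[ℂ] E) : Prop :=
  Summable fun i => (⟪someBasis E i, CFC.abs T (someBasis E i)⟫_ℂ).re

/-- The trace of a (trace class) operator. -/
def trace (T : E →L[ℂ] E) : ℂ :=
  ∑' i, ⟪someBasis E i, T (someBasis E i)⟫_ℂ

/-- Weak-`*` convergence in the trace class, regarded as the dual of the space of compact
operators: `Tr (T_N K) → Tr (T K)` for every compact operator `K`. -/
def TendstoWeakStar {X : Type*} (T : X → E →L[ℂ] E) (l : Filter X) (S : E →L[ℂ] E) : Prop :=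
  ∀ K : E →L[ℂ] E, IsCompactOperator K →
    Tendsto (fun N => trace (T N ∘L K)) l (𝓝 (trace (S ∘L K)))

end TraceClass

/-! ### Bosonic states and reduced density matrices -/

section States

variable {H : Type*} [NormedAddCommGroup H] [InnerProductSpace ℂ H]

/-- A bosonic `N`-body state: a positive (in particular self-adjoint) trace class operator with
trace one on the bosonic `N`-particle space. -/
structure IsBosonicState {N : ℕ} (Γ : SymPow H N →L[ℂ] SymPow H N) : Prop where
  isPositive : Γ.IsPositive
  isTraceClass : IsTraceClass Γ
  trace_eq_one : trace Γ = 1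

/-- The partial trace of `T` over the last `m` of the `k + m` tensor factors: with an orthonormal
basis `(e_j)` of `H` and `V_α x = x ⊗ e_{α 1} ⊗ ⋯ ⊗ e_{α m}`, it is `∑_α V_α* T V_α`. -/
def partialTrace [CompleteSpace H] (k m : ℕ) (T : TensorPow H (k + m) →L[ℂ] TensorPow H (k + m)) :
    TensorPow H k →L[ℂ] TensorPow H k :=
  ∑' α : Fin m → basisIndex H,
    (append k fun j => someBasis H (α j)).adjoint ∘L T ∘L (append k fun j => someBasis H (α j))

/-- The `k`-body reduced density matrix of an operator `Γ` on the bosonic space of `k + m`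
particles: extend `Γ` by zero to the full tensor power, take the partial trace over `m` particles,
and regard the result as an operator on the bosonic `k`-particle space. -/
def reducedDensityMatrix [CompleteSpace H] (k m : ℕ)
    (Γ : SymPow H (k + m) →L[ℂ] SymPow H (k + m)) : SymPow H k →L[ℂ] SymPow H k :=
  (symIncl H k).adjoint ∘L
    partialTrace k m (symIncl H (k + m) ∘L Γ ∘L (symIncl H (k + m)).adjoint) ∘L
    symIncl H k

end States

end DeFinetti

end

/-! As `N → ∞` the normalized one-body operators `N⁻¹ a*(f) a(g)` become classical commuting random
variables, and the de Finetti measure is their joint law.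

Let `C_f` be `create`, that is, tensoring with `f` followed by symmetrization, and let `T(f,g) = C_f
C_g*` (`oneBody`). Then `‖T(f,g)‖ ≤ ‖f‖‖g‖` for every `N`, and the canonical commutation relation
`(N+1) C_g* C_f = ⟨g,f⟩ + N T(f,g)` shows that reordering costs only `O(1/N)`. Since the `C_f`
commute, up to `O(1/N)` the `T`'s commute (`norm_oneBody_commutator_le`), satisfy `T(f,g)T(f',g') =
T(f,g')T(f',g)` (`norm_oneBody_mul_sub_exchange_le`), and have powers `T(f,g)^k = C_f^k (C_g^k)*`
(`exists_norm_oneBody_pow_sub_le`). The expectation of the last operator in `Γ_N` is exactly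
`⟨g^{⊗k}, γ_N^{(k)} f^{⊗k}⟩` (`inner_powTensor_reducedDensityMatrix`), which converges by testing
against rank-one operators.

An ultrafilter limit of the states, followed by the GNS construction, annihilates null sequences, so
the three relations become exact. Gelfand duality and Riesz–Markov then give continuous functions
`Z(f,g)` on a compact probability space whose moments are `⟨g^{⊗k}, γ^{(k)} f^{⊗k}⟩`
(`exists_classical_model`). At each point `Z` is a positive sesquilinear form bounded by one, and
the exchange relation forces its rank to be at most one: `Z(f,g) = ⟨g,u⟩⟨u,f⟩` with `‖u‖ ≤ 1` and
`u` measurable (`exists_measurable_vector`). The law of `u`, averaged over phases, is `μ`.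

For uniqueness, phase invariance kills the moments of `⟨g,u⟩` of unequal degrees in `⟨g,u⟩` and its
conjugate; the remaining ones are read off from `γ^{(k)}`. On the bounded ball these moments
determine the characteristic function, hence the measure (`eq_of_moments_eq`). -/

namespace DeFinetti

/-! ### Totality of pure tensors and of tensor powers -/

section Totality

variable {H : Type*} [NormedAddCommGroup H] [InnerProductSpace ℂ H]

theorem clm_ext_tprod {n : ℕ} {E : Type*} [NormedAddCommGroup E] [NormedSpace ℂ E]
    {A B : TensorPow H n →L[ℂ] E} (h : ∀ v, A (tprod v) = B (tprod v)) : A = B := by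
  ext x
  refine UniformSpace.Completion.induction_on (α := AlgTensorPower H n) x
    (isClosed_eq A.continuous B.continuous) fun a => ?_
  obtain ⟨c, rfl⟩ := exists_sum_algTprod a
  have key : ((c.sum fun v a => a • algTprod v : AlgTensorPower H n) :
      UniformSpace.Completion (AlgTensorPower H n))
      = c.sum fun v a => a • (tprod v : TensorPow H n) := by
    change UniformSpace.Completion.toComplL (𝕜 := ℂ) (E := AlgTensorPower H n) _ = _
    simp only [Finsupp.sum, map_sum, map_smul]
    rfl
  rw [key]
  simp only [Finsupp.sum]
  erw [map_sum, map_sum]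
  refine Finset.sum_congr rfl fun v _ => ?_
  erw [map_smul, map_smul, h]

theorem ext_inner_tprod {n : ℕ} {x y : TensorPow H n}
    (h : ∀ v, ⟪x, tprod v⟫_ℂ = ⟪y, tprod v⟫_ℂ) : x = y :=
  ext_inner_right ℂ fun z => DFunLike.congr_fun
    (clm_ext_tprod (A := innerSL ℂ x) (B := innerSL ℂ y) (by simpa using h)) z

theorem norm_tprod {n : ℕ} (v : Fin n → H) : ‖tprod v‖ = ∏ i, ‖v i‖ := by
  have h := inner_tprod v v
  simp only [inner_self_eq_norm_sq_to_K] at h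
  rw [Finset.prod_pow] at h
  have h2 : ‖tprod v‖ ^ 2 = (∏ i, ‖v i‖) ^ 2 := by
    have : ((‖tprod v‖ ^ 2 : ℝ) : ℂ) = (((∏ i, ‖v i‖) ^ 2 : ℝ) : ℂ) := by
      push_cast
      simpa using h
    exact_mod_cast this
  exact (pow_left_inj₀ (norm_nonneg _) (Finset.prod_nonneg fun i _ => norm_nonneg _)
    two_ne_zero).mp h2

/-- The pure tensor as a multilinear map into the Hilbert tensor power. -/
noncomputable def tprodMultilinear (H : Type*) [NormedAddCommGroup H] [InnerProductSpace ℂ H]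
    (n : ℕ) : MultilinearMap ℂ (fun _ : Fin n => H) (TensorPow H n) where
  toFun := tprod
  map_update_add' {inst} v i a b := by
    obtain rfl : inst = instDecidableEqFin n := Subsingleton.elim _ _
    refine ext_inner_tprod fun w => ?_
    rw [inner_add_left, inner_tprod, inner_tprod, inner_tprod, prod_update_add]
  map_update_smul' {inst} v i c a := by
    obtain rfl : inst = instDecidableEqFin n := Subsingleton.elim _ _
    refine ext_inner_tprod fun w => ?_
    rw [inner_smul_left, inner_tprod, inner_tprod, prod_update_smul]

@[simp] theorem tprodMultilinear_apply {n : ℕ} (v : Fin n → H) :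
    tprodMultilinear H n v = tprod v := rfl

theorem continuous_tprod {n : ℕ} : Continuous (tprod : (Fin n → H) → TensorPow H n) :=
  ((tprodMultilinear H n).mkContinuous 1 fun v => by
    rw [tprodMultilinear_apply, norm_tprod, one_mul]).cont

/-- A symmetric multilinear map that vanishes on the diagonal vanishes. -/
theorem multilinear_eq_zero_of_diag {n : ℕ} (φ : MultilinearMap ℂ (fun _ : Fin n => H) ℂ)
    (hs : ∀ (σ : Equiv.Perm (Fin n)) v, φ (fun i => v (σ i)) = φ v)
    (hd : ∀ u, φ (fun _ => u) = 0) (v : Fin n → H) : φ v = 0 := by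
  classical
  -- Polarization: expanding by multilinearity, the coefficient of `φ (v ∘ r)` in this alternating
  -- sum vanishes unless `r` is a bijection.
  have h1 : ∑ S : Finset (Fin n), (-1 : ℂ) ^ S.card * φ (fun _ => ∑ i ∈ S, v i) = 0 := by
    simp [hd]
  have h2 : ∀ S : Finset (Fin n), φ (fun _ => ∑ i ∈ S, v i)
      = ∑ r : Fin n → Fin n, if (∀ i, r i ∈ S) then φ (fun i => v (r i)) else 0 := by
    intro S
    rw [φ.map_sum_finset (fun _ j => v j) (fun _ => S), ← Finset.sum_filter]
    refine Finset.sum_congr ?_ fun _ _ => rfl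
    ext r
    simp
  simp only [h2, Finset.mul_sum] at h1
  rw [Finset.sum_comm] at h1
  have h3 : ∀ r : Fin n → Fin n, ∑ S : Finset (Fin n),
      (-1 : ℂ) ^ S.card * (if (∀ i, r i ∈ S) then φ (fun i => v (r i)) else 0)
      = if Function.Bijective r then (-1) ^ n * φ v else 0 := by
    intro r
    split_ifs with hr
    -- For surjective `r` only the full set contains the range.
    · rw [Finset.sum_eq_single Finset.univ]
      · simp only [Finset.mem_univ, implies_true, if_true, Finset.card_univ, Fintype.card_fin]
        rw [← hs (Equiv.ofBijective r hr) v]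
        rfl
      · intro S _ hS
        rw [if_neg, mul_zero]
        intro h
        refine hS (Finset.eq_univ_of_forall fun j => ?_)
        obtain ⟨i, rfl⟩ := hr.2 j
        exact h i
      · simp
    · have : ¬ Function.Surjective r := fun h => hr (Finite.surjective_iff_bijective.mp h)
      simp only [Function.Surjective, not_forall, not_exists] at this
      obtain ⟨j, hj⟩ := this
      -- Since `j` is missed by `r`, toggling the membership of `j` flips the sign of the term and
      -- leaves its condition unchanged.
      refine Finset.sum_involution (fun S _ => symmDiff S {j}) ?_ ?_ ?_ ?_
      · intro S _
        have hiff : (∀ i, r i ∈ symmDiff S {j}) ↔ ∀ i, r i ∈ S := by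
          refine forall_congr' fun i => ?_
          simp [Finset.mem_symmDiff, hj i]
        simp only [hiff]
        by_cases hjS : j ∈ S
        · have : symmDiff S {j} = S.erase j := by
            ext x; simp only [Finset.mem_symmDiff, Finset.mem_singleton, Finset.mem_erase]
            grind
          rw [this, ← Finset.card_erase_add_one hjS, pow_succ]
          ring
        · have : symmDiff S {j} = insert j S := by
            ext x; simp only [Finset.mem_symmDiff, Finset.mem_singleton, Finset.mem_insert]
            grind
          rw [this, Finset.card_insert_of_notMem hjS, pow_succ]
          ring
      · intro S _ _ h
        have := Finset.ext_iff.mp h j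
        simp [Finset.mem_symmDiff] at this
      · simp
      · intro S _
        exact symmDiff_symmDiff_cancel_right _ _
  simp only [h3] at h1
  rw [← Finset.sum_filter, Finset.sum_const, nsmul_eq_mul] at h1
  have hc : (Finset.univ.filter fun r : Fin n → Fin n => Function.Bijective r).card ≠ 0 :=
    Finset.card_ne_zero_of_mem (a := id) (Finset.mem_filter.mpr ⟨Finset.mem_univ _, Function.bijective_id⟩)
  have h4 := (mul_eq_zero.mp h1).resolve_left (by exact_mod_cast hc)
  exact (mul_eq_zero.mp h4).resolve_left (pow_ne_zero _ (by norm_num))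

theorem inner_permute {n : ℕ} (σ : Equiv.Perm (Fin n)) (x y : TensorPow H n) :
    ⟪permute σ x, permute σ y⟫_ℂ = ⟪x, y⟫_ℂ := by
  have h : (permute σ).adjoint ∘L permute σ = ContinuousLinearMap.id ℂ (TensorPow H n) := by
    refine clm_ext_tprod fun v => ext_inner_tprod fun w => ?_
    rw [ContinuousLinearMap.comp_apply, ContinuousLinearMap.adjoint_inner_left, permute_tprod,
      permute_tprod, inner_tprod, ContinuousLinearMap.id_apply, inner_tprod]
    exact Equiv.prod_comp σ.symm fun i => ⟪v i, w i⟫_ℂ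
  rw [← ContinuousLinearMap.adjoint_inner_left, ← ContinuousLinearMap.comp_apply, h]
  rfl

theorem inner_symIncl {n : ℕ} (x y : SymPow H n) :
    ⟪symIncl H n x, symIncl H n y⟫_ℂ = ⟪x, y⟫_ℂ := rfl

theorem permute_symIncl {n : ℕ} (σ : Equiv.Perm (Fin n)) (x : SymPow H n) :
    permute σ (symIncl H n x) = symIncl H n x := x.2 σ

theorem exists_symIncl {n : ℕ} {x : TensorPow H n}
    (h : ∀ σ : Equiv.Perm (Fin n), permute σ x = x) : ∃ y : SymPow H n, symIncl H n y = x :=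
  ⟨⟨x, h⟩, rfl⟩

theorem adjoint_symIncl_symIncl {n : ℕ} (x : SymPow H n) :
    (symIncl H n).adjoint (symIncl H n x) = x :=
  ext_inner_right ℂ fun y => by
    rw [ContinuousLinearMap.adjoint_inner_left, inner_symIncl]

theorem adjoint_symIncl_permute {n : ℕ} (σ : Equiv.Perm (Fin n)) (x : TensorPow H n) :
    (symIncl H n).adjoint (permute σ x) = (symIncl H n).adjoint x :=
  ext_inner_right ℂ fun y => by
    rw [ContinuousLinearMap.adjoint_inner_left, ContinuousLinearMap.adjoint_inner_left,
      ← inner_permute σ x, permute_symIncl]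

theorem norm_symIncl_le (n : ℕ) : ‖symIncl H n‖ ≤ 1 :=
  ContinuousLinearMap.opNorm_le_bound _ zero_le_one fun x => by rw [one_mul]; rfl

/-- The orthogonal projection of a pure tensor onto the bosonic space. -/
noncomputable def symTprod {n : ℕ} (v : Fin n → H) : SymPow H n :=
  (symIncl H n).adjoint (tprod v)

theorem symTprod_perm {n : ℕ} (v : Fin n → H) (σ : Equiv.Perm (Fin n)) :
    symTprod (fun i => v (σ i)) = symTprod v := by
  have := permute_tprod σ⁻¹ v
  unfold symTprod
  rw [← adjoint_symIncl_permute σ⁻¹ (tprod v), this]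
  rfl

theorem symIncl_powTensor {n : ℕ} (u : H) : symIncl H n (powTensor u n) = tprod fun _ => u := rfl

theorem symTprod_const {n : ℕ} (u : H) : symTprod (fun _ : Fin n => u) = powTensor u n := by
  unfold symTprod
  rw [← symIncl_powTensor, adjoint_symIncl_symIncl]

theorem clm_ext_symTprod {n : ℕ} {E : Type*} [NormedAddCommGroup E] [NormedSpace ℂ E]
    {A B : SymPow H n →L[ℂ] E} (h : ∀ v, A (symTprod v) = B (symTprod v)) : A = B := by
  have h1 : A ∘L (symIncl H n).adjoint = B ∘L (symIncl H n).adjoint := clm_ext_tprod h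
  ext x
  have := DFunLike.congr_fun h1 (symIncl H n x)
  simpa [adjoint_symIncl_symIncl] using this

/-- Polarization: `v ↦ ⟪x - y, symTprod v⟫` is symmetric and multilinear, so its values on the
diagonal determine it. Operator identities on the bosonic spaces can therefore be tested on powers
`u^{⊗n}`, where inner products are scalar powers. -/
theorem ext_inner_powTensor {n : ℕ} {x y : SymPow H n}
    (h : ∀ u, ⟪x, powTensor u n⟫_ℂ = ⟪y, powTensor u n⟫_ℂ) : x = y := by
  have h0 : ∀ v, ⟪x - y, symTprod v⟫_ℂ = 0 := by
    intro v
    refine multilinear_eq_zero_of_diag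
      (((innerSL ℂ (x - y)) ∘L (symIncl H n).adjoint).toLinearMap.compMultilinearMap
        (tprodMultilinear H n)) ?_ ?_ v
    · intro σ v
      exact congrArg (fun z => ⟪x - y, z⟫_ℂ) (symTprod_perm v σ)
    · intro u
      change ⟪x - y, symTprod fun _ => u⟫_ℂ = 0
      rw [symTprod_const, inner_sub_left, h, sub_self]
  refine ext_inner_right ℂ fun z => DFunLike.congr_fun
    (clm_ext_symTprod (A := innerSL ℂ x) (B := innerSL ℂ y) fun v => ?_) z
  have := h0 v
  rw [inner_sub_left, sub_eq_zero] at this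
  simpa using this

theorem clm_ext_powTensor {n m : ℕ} {A B : SymPow H n →L[ℂ] SymPow H m}
    (h : ∀ f g : H, ⟪powTensor g m, A (powTensor f n)⟫_ℂ = ⟪powTensor g m, B (powTensor f n)⟫_ℂ) :
    A = B := by
  have h1 : A.adjoint = B.adjoint := by
    ext x
    refine ext_inner_powTensor fun f => ?_
    rw [ContinuousLinearMap.adjoint_inner_left, ContinuousLinearMap.adjoint_inner_left]
    have : A (powTensor f n) = B (powTensor f n) := ext_inner_powTensor fun g => by
      rw [← inner_conj_symm, h, inner_conj_symm]
    rw [this]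
  exact ContinuousLinearMap.adjoint.injective h1

theorem inner_powTensor {n : ℕ} (u v : H) :
    ⟪powTensor u n, powTensor v n⟫_ℂ = ⟪u, v⟫_ℂ ^ n := by
  rw [← inner_symIncl, symIncl_powTensor, symIncl_powTensor, inner_tprod]
  simp

theorem norm_powTensor {n : ℕ} (u : H) : ‖powTensor u n‖ = ‖u‖ ^ n := by
  change ‖tprod (fun _ : Fin n => u)‖ = _
  rw [norm_tprod]; simp

theorem continuous_powTensor {n : ℕ} : Continuous fun u : H => powTensor u n :=
  Continuous.subtype_mk (continuous_tprod.comp (continuous_pi fun _ => continuous_id)) _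

end Totality

/-! ### Normalized creation and annihilation operators -/

section Fock

variable {H : Type*} [NormedAddCommGroup H] [InnerProductSpace ℂ H]

theorem norm_append_le (k : ℕ) {m : ℕ} (v : Fin m → H) : ‖append k v‖ ≤ ∏ i, ‖v i‖ := by
  unfold append
  refine ContinuousLinearMap.opNorm_le_bound _ (Finset.prod_nonneg fun i _ => norm_nonneg _)
    fun x => ?_
  refine UniformSpace.Completion.induction_on (α := AlgTensorPower H k) x ?_ fun a => ?_
  · exact isClosed_le (ContinuousLinearMap.continuous _).norm (continuous_const.mul continuous_norm)
  · erw [ContinuousLinearMap.completion_apply_coe, UniformSpace.Completion.norm_coe,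
      UniformSpace.Completion.norm_coe]
    exact norm_algAppend k v a

theorem append_permute (k : ℕ) {m : ℕ} (v : Fin m → H) (σ : Equiv.Perm (Fin k)) :
    ∃ τ : Equiv.Perm (Fin (k + m)), ∀ x, append k v (permute σ x) = permute τ (append k v x) := by
  let τ : Equiv.Perm (Fin (k + m)) :=
    finSumFinEquiv.symm.trans ((Equiv.sumCongr σ (Equiv.refl _)).trans finSumFinEquiv)
  refine ⟨τ, fun x => DFunLike.congr_fun (clm_ext_tprod
    (A := append k v ∘L permute σ) (B := permute τ ∘L append k v) fun w => ?_) x⟩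
  simp only [ContinuousLinearMap.comp_apply, permute_tprod, append_tprod]
  congr 1
  funext i
  refine Fin.addCases (fun i => ?_) (fun i => ?_) i
  · simp [τ]
  · simp [τ]

/-- Tensoring with a fixed pure tensor and then symmetrizing only depends on the symmetrization of
the first factor. -/
theorem adjoint_symIncl_append (k : ℕ) {m : ℕ} (v : Fin m → H) (x : TensorPow H k) :
    (symIncl H (k + m)).adjoint (append k v (symIncl H k ((symIncl H k).adjoint x)))
      = (symIncl H (k + m)).adjoint (append k v x) := by
  refine ext_inner_left ℂ fun y => ?_
  rw [ContinuousLinearMap.adjoint_inner_right, ContinuousLinearMap.adjoint_inner_right,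
    ← ContinuousLinearMap.adjoint_inner_left (append k v),
    ← ContinuousLinearMap.adjoint_inner_left (append k v)]
  -- Removing factors from a symmetric tensor leaves a symmetric one, because a permutation of the
  -- first `k` factors extends to all `k + m`. Projecting the first argument onto the symmetric
  -- subspace is then invisible.
  obtain ⟨z, hz⟩ := exists_symIncl (H := H) (n := k)
    (x := (append k v).adjoint (symIncl H (k + m) y)) fun σ => by
      refine ext_inner_right ℂ fun w => ?_
      obtain ⟨τ, hτ⟩ := append_permute k v σ⁻¹
      have h1 : permute σ (permute σ⁻¹ w) = w := by
        refine DFunLike.congr_fun (clm_ext_tprod (A := permute σ ∘L permute σ⁻¹)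
          (B := ContinuousLinearMap.id ℂ _) fun v => ?_) w
        simp only [ContinuousLinearMap.comp_apply, permute_tprod, ContinuousLinearMap.id_apply]
        congr 1
        funext i
        exact congrArg v (σ.apply_symm_apply i)
      nth_rewrite 1 [← h1]
      rw [inner_permute, ContinuousLinearMap.adjoint_inner_left, hτ,
        ContinuousLinearMap.adjoint_inner_left]
      conv_lhs => rw [← permute_symIncl τ y, inner_permute]
  rw [← hz, inner_symIncl, ContinuousLinearMap.adjoint_inner_right]

/-- The normalized creation operator: the symmetrized tensor product with `f`. -/
noncomputable def create (N : ℕ) (f : H) : SymPow H N →L[ℂ] SymPow H (N + 1) :=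
  (symIncl H (N + 1)).adjoint ∘L append N (fun _ : Fin 1 => f) ∘L symIncl H N

theorem create_symTprod {N : ℕ} (f : H) (v : Fin N → H) :
    create N f (symTprod v) = symTprod (Fin.append v fun _ : Fin 1 => f) := by
  unfold create symTprod
  simp only [ContinuousLinearMap.comp_apply]
  rw [adjoint_symIncl_append, append_tprod]

/-- Dropping the usual factor `√(N+1)` of `a*(f)` makes the bound uniform in `N`. -/
theorem norm_create_le (N : ℕ) (f : H) : ‖create N f‖ ≤ ‖f‖ := by
  unfold create
  have h1 := norm_symIncl_le (H := H) N
  have h2 : ‖(symIncl H (N + 1)).adjoint‖ ≤ 1 := by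
    rw [LinearIsometryEquiv.norm_map]; exact norm_symIncl_le _
  have h3 := norm_append_le N (fun _ : Fin 1 => f)
  simp only [Finset.univ_unique, Finset.prod_singleton] at h3
  calc _ ≤ 1 * (‖f‖ * 1) := by
        refine (ContinuousLinearMap.opNorm_comp_le _ _).trans ?_
        refine mul_le_mul h2 ((ContinuousLinearMap.opNorm_comp_le _ _).trans ?_)
          (norm_nonneg _) zero_le_one
        exact mul_le_mul h3 h1 (norm_nonneg _) (norm_nonneg _)
    _ = ‖f‖ := by ring

/-- Against a power vector, creation is multiplication by a scalar. Linearity and commutativity of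
`create` reduce to the corresponding facts about scalars. -/
theorem inner_powTensor_create {N : ℕ} (f v : H) (x : SymPow H N) :
    ⟪powTensor v (N + 1), create N f x⟫_ℂ = ⟪v, f⟫_ℂ * ⟪powTensor v N, x⟫_ℂ := by
  refine DFunLike.congr_fun (clm_ext_symTprod (A := innerSL ℂ (powTensor v (N + 1)) ∘L create N f)
    (B := ⟪v, f⟫_ℂ • innerSL ℂ (powTensor v N)) fun w => ?_) x
  simp only [ContinuousLinearMap.comp_apply, create_symTprod, smul_apply, innerSL_apply_apply]
  simp only [symTprod, ContinuousLinearMap.adjoint_inner_right, symIncl_powTensor,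
    inner_tprod, Fin.prod_univ_add, Fin.append_left, Fin.append_right, smul_eq_mul]
  simp [mul_comm]

theorem adjoint_create_powTensor {N : ℕ} (g u : H) :
    (create N g).adjoint (powTensor u (N + 1)) = ⟪g, u⟫_ℂ • powTensor u N :=
  ext_inner_right ℂ fun x => by
    rw [ContinuousLinearMap.adjoint_inner_left, inner_powTensor_create, inner_smul_left,
      inner_conj_symm]

theorem create_add (N : ℕ) (f g : H) : create N (f + g) = create N f + create N g := by
  refine ContinuousLinearMap.ext fun x => ext_inner_powTensor fun u => ?_
  rw [← inner_conj_symm, ← inner_conj_symm _ (powTensor u (N + 1))]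
  simp only [inner_powTensor_create, add_apply, inner_add_right, add_mul]

theorem create_smul (N : ℕ) (c : ℂ) (f : H) : create N (c • f) = c • create N f := by
  refine ContinuousLinearMap.ext fun x => ext_inner_powTensor fun u => ?_
  rw [← inner_conj_symm, ← inner_conj_symm _ (powTensor u (N + 1))]
  simp only [inner_powTensor_create, smul_apply, inner_smul_right, mul_assoc]

theorem create_comm (N : ℕ) (f g : H) :
    create (N + 1) f ∘L create N g = create (N + 1) g ∘L create N f := by
  refine ContinuousLinearMap.ext fun x => ext_inner_powTensor fun u => ?_
  rw [← inner_conj_symm, ← inner_conj_symm _ (powTensor u (N + 2))]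
  simp only [inner_powTensor_create, ContinuousLinearMap.comp_apply]
  ring_nf

/-- The symmetrization of `u^{⊗N} ⊗ f` is the average over the `N + 1` slots that `f` may occupy.
Paired with a vector having `g` in slot `0`, the case of `f` in the same slot gives the first term,
and each of the other `N` slots gives one copy of the second. The truncated exponent at `N = 0` is
harmless because of the factor `N`. -/
theorem inner_create_create_powTensor (N : ℕ) (f g u v : H) :
    ((N + 1 : ℕ) : ℂ) * ⟪create N g (powTensor v N), create N f (powTensor u N)⟫_ℂ
      = ⟪g, f⟫_ℂ * ⟪v, u⟫_ℂ ^ N + N * (⟪v, f⟫_ℂ * ⟪g, u⟫_ℂ * ⟪v, u⟫_ℂ ^ (N - 1)) := by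
  classical
  let w : H → H → Fin (N + 1) → (Fin (N + 1) → H) := fun u f i => Function.update (fun _ => u) i f
  -- The slot in which `f` is inserted does not matter after symmetrization.
  have hc : ∀ u f i, create N f (powTensor u N) = symTprod (w u f i) := by
    intro u f i
    rw [← symTprod_const, create_symTprod, ← symTprod_perm _ (Equiv.swap i (Fin.last N))]
    congr 1
    funext j
    by_cases hj : j = i
    · subst hj
      have : Fin.last N = Fin.natAdd N (0 : Fin 1) := by ext; simp
      simp only [Equiv.swap_apply_left, w, Function.update_self]
      rw [this, Fin.append_right]
    · simp only [w, Function.update_of_ne hj]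
      have : Equiv.swap i (Fin.last N) j ≠ Fin.last N := by
        intro h
        apply hj
        have := congrArg (Equiv.swap i (Fin.last N)) h
        simpa using this
      obtain ⟨a, ha⟩ := Fin.exists_castSucc_eq.mpr this
      rw [← ha]
      exact Fin.append_left (fun _ => u) (fun _ : Fin 1 => f) a
  -- The sum over all slots is already symmetric, so one of the two projections can be dropped.
  have hsum : ∃ y, symIncl H (N + 1) y = ∑ i, tprod (w u f i) := by
    refine exists_symIncl fun σ => ?_
    rw [map_sum]
    refine (Finset.sum_congr rfl fun i _ => ?_).trans
      (Equiv.sum_comp σ fun i => (tprod (w u f i) : TensorPow H (N + 1)))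
    rw [permute_tprod]
    congr 1
    funext j
    simp only [w, Function.update_apply, Equiv.symm_apply_eq]
  obtain ⟨y, hy⟩ := hsum
  have hy2 : y = ((N + 1 : ℕ) : ℂ) • create N f (powTensor u N) := by
    rw [← adjoint_symIncl_symIncl y, hy, map_sum]
    have : ∀ i ∈ Finset.univ, (symIncl H (N + 1)).adjoint (tprod (w u f i))
        = create N f (powTensor u N) := fun i _ => (hc u f i).symm
    rw [Finset.sum_congr rfl this, Finset.sum_const, Finset.card_univ, Fintype.card_fin,
      Nat.cast_smul_eq_nsmul]
  rw [← inner_smul_right, ← hy2, hc v g 0, symTprod, ContinuousLinearMap.adjoint_inner_left, hy,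
    inner_sum, Fin.sum_univ_succ]
  congr 1
  · rw [inner_tprod, Fin.prod_univ_succ]
    simp [w, Function.update_of_ne]
  · have : ∀ i : Fin N, ⟪tprod (w v g 0), tprod (w u f i.succ)⟫_ℂ
        = ⟪v, f⟫_ℂ * ⟪g, u⟫_ℂ * ⟪v, u⟫_ℂ ^ (N - 1) := by
      intro i
      rw [inner_tprod, Fin.prod_univ_succ, ← Finset.mul_prod_erase _ _ (Finset.mem_univ i)]
      have h1 : ∀ j ∈ Finset.univ.erase i, ⟪w v g 0 j.succ, w u f i.succ j.succ⟫_ℂ = ⟪v, u⟫_ℂ := by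
        intro j hj
        have h2 : j.succ ≠ i.succ := fun h => (Finset.ne_of_mem_erase hj) (Fin.succ_injective _ h)
        simp [w, Function.update_of_ne h2]
      rw [Finset.prod_congr rfl h1, Finset.prod_const, Finset.card_erase_of_mem (Finset.mem_univ i),
        Finset.card_univ, Fintype.card_fin]
      have h3 : (0 : Fin (N + 1)) ≠ i.succ := (Fin.succ_ne_zero i).symm
      simp [w, Function.update_of_ne h3]
      ring
    rw [Finset.sum_congr rfl fun i _ => this i, Finset.sum_const, Finset.card_univ,
      Fintype.card_fin, nsmul_eq_mul]

/-- The normalized one-body operator `N⁻¹ a*(f) a(g)`. -/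
noncomputable def oneBody (f g : H) : ∀ N : ℕ, SymPow H N →L[ℂ] SymPow H N
  -- There is nothing to annihilate in the vacuum sector; this value enters the commutation relation
  -- with coefficient `N = 0`.
  | 0 => 0
  | N + 1 => create N f ∘L (create N g).adjoint

/-- The canonical commutation relation, for normalized operators. -/
theorem adjoint_create_comp_create (N : ℕ) (f g : H) :
    ((N + 1 : ℕ) : ℂ) • ((create N g).adjoint ∘L create N f)
      = ⟪g, f⟫_ℂ • ContinuousLinearMap.id ℂ (SymPow H N) + (N : ℂ) • oneBody f g N := by
  refine clm_ext_powTensor fun u v => ?_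
  rw [smul_apply, inner_smul_right, ContinuousLinearMap.comp_apply,
    ContinuousLinearMap.adjoint_inner_right, inner_create_create_powTensor]
  rw [add_apply, smul_apply,
    smul_apply, inner_add_right, inner_smul_right, inner_smul_right,
    ContinuousLinearMap.id_apply, inner_powTensor]
  congr 1
  cases N with
  | zero => simp
  | succ N =>
    congr 1
    simp only [oneBody, ContinuousLinearMap.comp_apply, Nat.add_sub_cancel]
    rw [inner_powTensor_create, adjoint_create_powTensor, inner_smul_right, inner_powTensor,
      mul_assoc]

theorem norm_oneBody_le (f g : H) (N : ℕ) : ‖oneBody f g N‖ ≤ ‖f‖ * ‖g‖ := by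
  cases N with
  | zero => simp only [oneBody, norm_zero]; positivity
  | succ N =>
    refine (ContinuousLinearMap.opNorm_comp_le _ _).trans ?_
    rw [LinearIsometryEquiv.norm_map]
    exact mul_le_mul (norm_create_le N f) (norm_create_le N g) (norm_nonneg _) (norm_nonneg _)

/-- By the commutation relation the difference is `(⟨g,f⟩ - T(f,g)) / (N+1)`. This is the only
source of the `1/N` errors below. -/
theorem norm_adjoint_create_comp_create_sub_le (N : ℕ) (f g : H) :
    ‖(create N g).adjoint ∘L create N f - oneBody f g N‖ ≤ 2 * (‖f‖ * ‖g‖) / (N + 1) := by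
  have h := adjoint_create_comp_create N f g
  have h1 : ((N + 1 : ℕ) : ℂ) • ((create N g).adjoint ∘L create N f - oneBody f g N)
      = ⟪g, f⟫_ℂ • ContinuousLinearMap.id ℂ (SymPow H N) - oneBody f g N := by
    rw [smul_sub, h]
    push_cast
    rw [add_smul, one_smul]
    abel
  have h2 := congrArg norm h1
  rw [norm_smul, Complex.norm_natCast] at h2
  push_cast at h2
  rw [le_div_iff₀ (by positivity), mul_comm, h2]
  refine (norm_sub_le _ _).trans ?_
  rw [norm_smul]
  have h3 := norm_inner_le_norm (𝕜 := ℂ) g f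
  have h4 := ContinuousLinearMap.norm_id_le (𝕜 := ℂ) (E := SymPow H N)
  have h5 := norm_oneBody_le f g N
  nlinarith [norm_nonneg ⟪g, f⟫_ℂ]

end Fock

/-! ### Asymptotic relations between the one-body operators -/

section Asymptotics

theorem norm_clm_pow_le {E : Type*} [NormedAddCommGroup E] [NormedSpace ℂ E] {X : E →L[ℂ] E}
    {R : ℝ} (hX : ‖X‖ ≤ R) (k : ℕ) : ‖X ^ k‖ ≤ R ^ k := by
  induction k with
  | zero =>
    rw [pow_zero, pow_zero]
    exact ContinuousLinearMap.norm_id_le (𝕜 := ℂ) (E := E)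
  | succ k ih =>
    rw [pow_succ, pow_succ]
    exact (norm_mul_le _ _).trans (mul_le_mul ih hX (norm_nonneg _) ((norm_nonneg _).trans ih))

/-- Telescoping. The factor `R` on the left avoids the exponent `k - 1`, and is the factor supplied
by the outer creation and annihilation operators where the bound is applied. -/
theorem norm_clm_pow_sub_pow_le {E : Type*} [NormedAddCommGroup E] [NormedSpace ℂ E]
    {X Y : E →L[ℂ] E} {R : ℝ} (hR : 0 ≤ R) (hX : ‖X‖ ≤ R) (hY : ‖Y‖ ≤ R) (k : ℕ) :
    R * ‖X ^ k - Y ^ k‖ ≤ k * R ^ k * ‖X - Y‖ := by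
  induction k with
  | zero => simp
  | succ k ih =>
    have h1 : X ^ (k + 1) - Y ^ (k + 1) = X ^ k * (X - Y) + (X ^ k - Y ^ k) * Y := by
      rw [pow_succ, pow_succ]; noncomm_ring
    have h2 : ‖X ^ (k + 1) - Y ^ (k + 1)‖ ≤ R ^ k * ‖X - Y‖ + ‖X ^ k - Y ^ k‖ * R := by
      rw [h1]
      refine (norm_add_le _ _).trans (add_le_add ((norm_mul_le _ _).trans ?_)
        ((norm_mul_le _ _).trans ?_))
      · exact mul_le_mul_of_nonneg_right (norm_clm_pow_le hX k) (norm_nonneg _)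
      · exact mul_le_mul_of_nonneg_left hY (norm_nonneg _)
    have h3 := mul_le_mul_of_nonneg_left h2 hR
    have h4 := mul_le_mul_of_nonneg_left ih hR
    push_cast
    rw [pow_succ R k]
    linarith

variable {H : Type*} [NormedAddCommGroup H] [InnerProductSpace ℂ H]

theorem norm_create_comp_comp_adjoint_le (N : ℕ) (f g : H) (A : SymPow H N →L[ℂ] SymPow H N) :
    ‖create N f ∘L A ∘L (create N g).adjoint‖ ≤ ‖f‖ * ‖g‖ * ‖A‖ := by
  refine (ContinuousLinearMap.opNorm_comp_le _ _).trans ?_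
  have h1 := ContinuousLinearMap.opNorm_comp_le A (create N g).adjoint
  rw [LinearIsometryEquiv.norm_map] at h1
  calc _ ≤ ‖f‖ * (‖A‖ * ‖g‖) := mul_le_mul (norm_create_le N f)
        (h1.trans (mul_le_mul_of_nonneg_left (norm_create_le N g) (norm_nonneg _)))
        (norm_nonneg _) (norm_nonneg _)
    _ = _ := by ring

/-- Normal ordering: only the middle pair `C_g* C_{f'}` is exchanged. -/
theorem norm_oneBody_mul_sub_le (N : ℕ) (f g f' g' : H) :
    ‖oneBody f g (N + 1) * oneBody f' g' (N + 1)
      - create N f ∘L oneBody f' g N ∘L (create N g').adjoint‖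
      ≤ 2 * (‖f‖ * ‖g‖ * ‖f'‖ * ‖g'‖) / (N + 1) := by
  have h : oneBody f g (N + 1) * oneBody f' g' (N + 1)
      - create N f ∘L oneBody f' g N ∘L (create N g').adjoint
      = create N f ∘L ((create N g).adjoint ∘L create N f' - oneBody f' g N)
        ∘L (create N g').adjoint := by
    ext x
    simp [oneBody]
  rw [h]
  refine (norm_create_comp_comp_adjoint_le _ _ _ _).trans ?_
  have := norm_adjoint_create_comp_create_sub_le N f' g
  calc _ ≤ ‖f‖ * ‖g'‖ * (2 * (‖f'‖ * ‖g‖) / (N + 1)) :=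
        mul_le_mul_of_nonneg_left this (by positivity)
    _ = _ := by ring

theorem create_comp_oneBody_comp (N : ℕ) (f g f' g' : H) :
    create (N + 1) f ∘L oneBody f' g (N + 1) ∘L (create (N + 1) g').adjoint
      = (create (N + 1) f ∘L create N f') ∘L (create (N + 1) g' ∘L create N g).adjoint := by
  rw [ContinuousLinearMap.adjoint_comp]
  rfl

/-- Both products have the same normally ordered form `C_f C_{f'} (C_{g'} C_g)*`, since creation
operators commute. In the limit this relation says that the form `T(f,g)` has rank at most one. -/
theorem norm_oneBody_mul_sub_exchange_le (N : ℕ) (f g f' g' : H) :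
    ‖oneBody f g (N + 1) * oneBody f' g' (N + 1)
      - oneBody f g' (N + 1) * oneBody f' g (N + 1)‖
      ≤ 4 * (‖f‖ * ‖g‖ * ‖f'‖ * ‖g'‖) / (N + 1) := by
  have h1 := norm_oneBody_mul_sub_le N f g f' g'
  have h2 := norm_oneBody_mul_sub_le N f g' f' g
  have h3 : create N f ∘L oneBody f' g N ∘L (create N g').adjoint
      = create N f ∘L oneBody f' g' N ∘L (create N g).adjoint := by
    cases N with
    | zero => simp [oneBody]
    | succ N => rw [create_comp_oneBody_comp, create_comp_oneBody_comp, create_comm N g' g]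
  rw [h3] at h1
  rw [norm_sub_rev] at h2
  refine (norm_sub_le_norm_sub_add_norm_sub _ _ _).trans ((add_le_add h1 h2).trans (le_of_eq ?_))
  ring

theorem norm_oneBody_commutator_le (N : ℕ) (f g f' g' : H) :
    ‖oneBody f g (N + 1) * oneBody f' g' (N + 1)
      - oneBody f' g' (N + 1) * oneBody f g (N + 1)‖
      ≤ 4 * (‖f‖ * ‖g‖ * ‖f'‖ * ‖g'‖) / (N + 1) := by
  have h1 := norm_oneBody_mul_sub_le N f g f' g'
  have h2 := norm_oneBody_mul_sub_le N f' g' f g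
  have h3 : create N f ∘L oneBody f' g N ∘L (create N g').adjoint
      = create N f' ∘L oneBody f g' N ∘L (create N g).adjoint := by
    cases N with
    | zero => simp [oneBody]
    | succ N =>
      rw [create_comp_oneBody_comp, create_comp_oneBody_comp, create_comm N g' g,
        create_comm N f f']
  rw [h3] at h1
  rw [norm_sub_rev] at h2
  refine (norm_sub_le_norm_sub_add_norm_sub _ _ _).trans ((add_le_add h1 h2).trans (le_of_eq ?_))
  ring

/-- The symmetrized tensor product with `f^{⊗ k}`. -/
noncomputable def createPow (f : H) (m : ℕ) : ∀ k : ℕ, SymPow H m →L[ℂ] SymPow H (m + k)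
  | 0 => ContinuousLinearMap.id ℂ _
  | k + 1 => create (m + k) f ∘L createPow f m k

theorem createPow_symTprod (f : H) {m : ℕ} (v : Fin m → H) (k : ℕ) :
    createPow f m k (symTprod v) = symTprod (Fin.append v fun _ : Fin k => f) := by
  induction k with
  | zero =>
    have : (Fin.append v fun _ : Fin 0 => f) = v := by
      funext i; exact Fin.append_left v (fun _ : Fin 0 => f) i
    rw [this]
    rfl
  | succ k ih =>
    rw [createPow, ContinuousLinearMap.comp_apply, ih, create_symTprod]
    congr 1
    funext i
    refine Fin.lastCases ?_ (fun j => ?_) i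
    · exact (Fin.append_right (Fin.append v fun _ : Fin k => f) (fun _ : Fin 1 => f) 0).trans
        (Fin.append_right v (fun _ : Fin (k + 1) => f) (Fin.last k)).symm
    · refine (Fin.append_left (Fin.append v fun _ : Fin k => f) (fun _ : Fin 1 => f) j).trans ?_
      refine Fin.addCases (fun a => ?_) (fun a => ?_) j
      · rw [Fin.append_left]
        exact (Fin.append_left v (fun _ : Fin (k + 1) => f) a).symm
      · rw [Fin.append_right]
        exact (Fin.append_right v (fun _ : Fin (k + 1) => f) a.castSucc).symm

theorem oneBody_pow_succ (f g : H) (N k : ℕ) :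
    oneBody f g (N + 1) ^ (k + 1)
      = create N f ∘L (((create N g).adjoint ∘L create N f) ^ k) ∘L (create N g).adjoint := by
  induction k with
  | zero => rw [zero_add, pow_one]; rfl
  | succ k ih =>
    rw [pow_succ, ih, pow_succ]
    rfl

/-- Induction by peeling off the outermost `C_f` and `C_g*`. What remains inside is `(C_g* C_f)^k`,
which is first compared with `T(f,g)^k` on `m + k` particles and then, by induction, with the
normally ordered power. -/
theorem exists_norm_oneBody_pow_sub_le (f g : H) (k : ℕ) :
    ∃ C : ℝ, ∀ m : ℕ, ‖oneBody f g (m + k) ^ k - createPow f m k ∘L (createPow g m k).adjoint‖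
      ≤ C / (m + 1) := by
  induction k with
  | zero =>
    refine ⟨0, fun m => ?_⟩
    simp only [createPow, pow_zero, ContinuousLinearMap.adjoint_id, ContinuousLinearMap.id_comp,
      zero_div]
    exact le_of_eq (by rw [norm_eq_zero]; exact sub_self _)
  | succ k ih =>
    obtain ⟨C, hC⟩ := ih
    set R := ‖f‖ * ‖g‖ with hR
    have hR0 : 0 ≤ R := by positivity
    -- The first summand pays for replacing `C_g* C_f` by `T(f,g)` inside a `k`-th power, the second
    -- for the induction hypothesis between two outer operators.
    refine ⟨k * R ^ k * (2 * R) + R * C, fun m => ?_⟩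
    have e : oneBody f g (m + (k + 1)) ^ (k + 1)
        - createPow f m (k + 1) ∘L (createPow g m (k + 1)).adjoint
        = create (m + k) f ∘L (((create (m + k) g).adjoint ∘L create (m + k) f) ^ k
            - oneBody f g (m + k) ^ k) ∘L (create (m + k) g).adjoint
          + create (m + k) f ∘L (oneBody f g (m + k) ^ k
            - createPow f m k ∘L (createPow g m k).adjoint) ∘L (create (m + k) g).adjoint := by
      rw [createPow, createPow, ContinuousLinearMap.adjoint_comp]
      erw [oneBody_pow_succ f g (m + k) k]
      ext x
      simp
    rw [e]
    refine (norm_add_le _ _).trans ?_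
    rw [add_div]
    refine add_le_add ?_ ?_
    · refine (norm_create_comp_comp_adjoint_le _ _ _ _).trans ?_
      refine (norm_clm_pow_sub_pow_le hR0 ?_ (norm_oneBody_le f g (m + k)) k).trans ?_
      · refine (ContinuousLinearMap.opNorm_comp_le _ _).trans ?_
        rw [LinearIsometryEquiv.norm_map, mul_comm]
        exact mul_le_mul (norm_create_le _ f) (norm_create_le _ g) (norm_nonneg _) (norm_nonneg _)
      · rw [mul_div_assoc]
        refine mul_le_mul_of_nonneg_left
          ((norm_adjoint_create_comp_create_sub_le (m + k) f g).trans ?_) (by positivity)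
        push_cast
        have : (m : ℝ) + 1 ≤ m + k + 1 := by linarith [(Nat.cast_nonneg k : (0 : ℝ) ≤ k)]
        gcongr
    · refine (norm_create_comp_comp_adjoint_le _ _ _ _).trans ?_
      rw [mul_div_assoc]
      exact mul_le_mul_of_nonneg_left (hC m) hR0

theorem adjoint_oneBody (f g : H) (N : ℕ) : (oneBody f g N).adjoint = oneBody g f N := by
  cases N with
  | zero => simp [oneBody]
  | succ N => simp only [oneBody, ContinuousLinearMap.adjoint_comp,
      ContinuousLinearMap.adjoint_adjoint]

theorem oneBody_add (f f' g : H) (N : ℕ) :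
    oneBody (f + f') g N = oneBody f g N + oneBody f' g N := by
  cases N with
  | zero => simp [oneBody]
  | succ N => simp only [oneBody, create_add, ContinuousLinearMap.add_comp]

theorem oneBody_smul (c : ℂ) (f g : H) (N : ℕ) : oneBody (c • f) g N = c • oneBody f g N := by
  cases N with
  | zero => simp [oneBody]
  | succ N => simp only [oneBody, create_smul, ContinuousLinearMap.smul_comp]

/-- The order relation `0 ≤ T(f,f) ≤ ‖f‖²` is recorded as a norm bound because contractive
homomorphisms preserve norm bounds directly; positivity is recovered from it in
`exists_measurable_vector`. -/
theorem norm_smul_one_sub_oneBody_le (f : H) (N : ℕ) :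
    ‖((‖f‖ ^ 2 : ℝ) : ℂ) • (1 : SymPow H N →L[ℂ] SymPow H N) - oneBody f f N‖ ≤ ‖f‖ ^ 2 := by
  have h0 : 0 ≤ oneBody f f N := by
    rw [ContinuousLinearMap.nonneg_iff_isPositive]
    cases N with
    | zero => exact ContinuousLinearMap.isPositive_zero
    | succ N => exact ContinuousLinearMap.isPositive_self_comp_adjoint _
  have e : ((‖f‖ ^ 2 : ℝ) : ℂ) • (1 : SymPow H N →L[ℂ] SymPow H N)
      = algebraMap ℝ (SymPow H N →L[ℂ] SymPow H N) (‖f‖ ^ 2) := by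
    rw [Algebra.algebraMap_eq_smul_one]; rfl
  rw [e]
  have h1 : oneBody f f N ≤ algebraMap ℝ _ (‖f‖ ^ 2) := by
    rw [← CStarAlgebra.norm_le_iff_le_algebraMap _ (by positivity) h0, sq]
    exact norm_oneBody_le f f N
  rw [CStarAlgebra.norm_le_iff_le_algebraMap _ (by positivity) (sub_nonneg.mpr h1)]
  exact sub_le_self _ h0

end Asymptotics

/-! ### Hilbert–Schmidt sums -/

section HilbertSchmidt

variable {E F : Type*} [NormedAddCommGroup E] [InnerProductSpace ℂ E]
  [NormedAddCommGroup F] [InnerProductSpace ℂ F] {ι κ : Type*}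

theorem hasSum_norm_inner_sq (b : HilbertBasis ι ℂ E) (x : E) :
    HasSum (fun i => ‖⟪b i, x⟫_ℂ‖ ^ 2) (‖x‖ ^ 2) := by
  have h := Complex.hasSum_re (b.hasSum_inner_mul_inner x x)
  have e : ∀ i, (⟪x, b i⟫_ℂ * ⟪b i, x⟫_ℂ).re = ‖⟪b i, x⟫_ℂ‖ ^ 2 := by
    intro i
    rw [← inner_conj_symm, Complex.conj_mul', ← Complex.ofReal_pow, Complex.ofReal_re]
  have e2 : (⟪x, x⟫_ℂ).re = ‖x‖ ^ 2 := inner_self_eq_norm_sq (𝕜 := ℂ) x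
  simpa only [e, e2] using h

variable [CompleteSpace E] [CompleteSpace F]

/-- The operator norm is at most the Hilbert–Schmidt norm, computed here from the adjoint. -/
theorem norm_sq_le_tsum_adjoint (e : HilbertBasis κ ℂ E) (A : F →L[ℂ] E)
    (hA : Summable fun i => ‖A.adjoint (e i)‖ ^ 2) : ‖A‖ ^ 2 ≤ ∑' i, ‖A.adjoint (e i)‖ ^ 2 := by
  have h0 : 0 ≤ ∑' i, ‖A.adjoint (e i)‖ ^ 2 := tsum_nonneg fun i => sq_nonneg _
  rw [← Real.sqrt_le_sqrt_iff h0, Real.sqrt_sq (norm_nonneg _)]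
  refine ContinuousLinearMap.opNorm_le_bound _ (Real.sqrt_nonneg _) fun x => ?_
  rw [← Real.sqrt_sq (norm_nonneg x), ← Real.sqrt_mul h0]
  refine Real.le_sqrt_of_sq_le ?_
  have h1 := hasSum_norm_inner_sq e (A x)
  rw [← h1.tsum_eq, ← tsum_mul_right]
  refine h1.summable.tsum_le_tsum (fun i => ?_) (hA.mul_right _)
  rw [← ContinuousLinearMap.adjoint_inner_left, ← mul_pow]
  exact pow_le_pow_left₀ (norm_nonneg _) (norm_inner_le_norm _ _) 2

/-- Cyclicity `Tr A*B = Tr BA*` for Hilbert–Schmidt operators: expand in both bases and exchange the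
absolutely convergent sums. -/
theorem tsum_inner_eq_tsum_inner_adjoint (t : HilbertBasis ι ℂ F) (e : HilbertBasis κ ℂ E)
    (A B : F →L[ℂ] E) (hA : Summable fun i => ‖A.adjoint (e i)‖ ^ 2)
    (hB : Summable fun i => ‖B.adjoint (e i)‖ ^ 2) :
    ∑' a, ⟪A (t a), B (t a)⟫_ℂ = ∑' i, ⟪B.adjoint (e i), A.adjoint (e i)⟫_ℂ := by
  have hsq : ∀ C : F →L[ℂ] E, (Summable fun i => ‖C.adjoint (e i)‖ ^ 2) →
      Summable fun p : κ × ι => ‖⟪t p.2, C.adjoint (e p.1)⟫_ℂ‖ ^ 2 := by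
    intro C hC
    refine (summable_prod_of_nonneg fun p => sq_nonneg _).mpr ⟨fun i => ?_, ?_⟩
    · exact (hasSum_norm_inner_sq t (C.adjoint (e i))).summable
    · simpa only [(hasSum_norm_inner_sq t _).tsum_eq] using hC
  have hs : Summable (Function.uncurry fun (i : κ) (a : ι) =>
      ⟪B.adjoint (e i), t a⟫_ℂ * ⟪t a, A.adjoint (e i)⟫_ℂ) := by
    refine Summable.of_norm_bounded ((hsq A hA).add (hsq B hB)) fun p => ?_
    rw [Function.uncurry, norm_mul, norm_inner_symm]
    nlinarith [sq_nonneg (‖⟪t p.2, A.adjoint (e p.1)⟫_ℂ‖ - ‖⟪t p.2, B.adjoint (e p.1)⟫_ℂ‖),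
      norm_nonneg ⟪t p.2, A.adjoint (e p.1)⟫_ℂ, norm_nonneg ⟪t p.2, B.adjoint (e p.1)⟫_ℂ]
  have h1 : ∀ i, ⟪B.adjoint (e i), A.adjoint (e i)⟫_ℂ
      = ∑' a, ⟪B.adjoint (e i), t a⟫_ℂ * ⟪t a, A.adjoint (e i)⟫_ℂ :=
    fun i => (t.tsum_inner_mul_inner _ _).symm
  have h2 : ∀ a, ⟪A (t a), B (t a)⟫_ℂ
      = ∑' i, ⟪B.adjoint (e i), t a⟫_ℂ * ⟪t a, A.adjoint (e i)⟫_ℂ := by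
    intro a
    rw [← e.tsum_inner_mul_inner]
    refine tsum_congr fun i => ?_
    rw [ContinuousLinearMap.adjoint_inner_left, ContinuousLinearMap.adjoint_inner_right, mul_comm]
  simp only [h1, h2]
  exact hs.tsum_comm

end HilbertSchmidt

/-! ### Product bases of the tensor powers -/

section ProductBasis

variable {H : Type*} [NormedAddCommGroup H] [InnerProductSpace ℂ H] {ι : Type*}

theorem orthonormal_tprod {v : ι → H} (hv : Orthonormal ℂ v) (m : ℕ) :
    Orthonormal ℂ fun α : Fin m → ι => tprod fun j => v (α j) := by
  classical
  rw [orthonormal_iff_ite] at hv ⊢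
  intro α β
  rw [inner_tprod]
  simp only [hv]
  rw [Finset.prod_ite_zero]
  simp [funext_iff]

theorem orthogonal_span_tprod (b : HilbertBasis ι ℂ H) (m : ℕ) :
    (Submodule.span ℂ (Set.range fun α : Fin m → ι => tprod fun j => b (α j)))ᗮ = ⊥ := by
  classical
  rw [Submodule.eq_bot_iff]
  intro x hx
  have hx' : ∀ α : Fin m → ι, ⟪x, tprod fun j => b (α j)⟫_ℂ = 0 := fun α =>
    (Submodule.mem_orthogonal' _ _).mp hx _ (Submodule.subset_span ⟨α, rfl⟩)
  -- The slots in `s` may hold arbitrary vectors, the others basis vectors. Each slot is freed by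
  -- density of the span of `b` and continuity in that slot.
  have key : ∀ s : Finset (Fin m), ∀ v : Fin m → H, (∀ j ∉ s, v j ∈ Set.range b) →
      ⟪x, tprod v⟫_ℂ = 0 := by
    intro s
    induction s using Finset.induction_on with
    | empty =>
      intro v hv
      choose α hα using fun j => hv j (Finset.notMem_empty j)
      rw [← hx' α]
      simp only [hα]
    | insert j s hj ih =>
      intro v hv
      let L : H →L[ℂ] ℂ :=
        { toLinearMap := (innerₛₗ ℂ x) ∘ₗ (tprodMultilinear H m).toLinearMap v j
          cont := continuous_const.inner
            (continuous_tprod.comp (continuous_const.update j continuous_id)) }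
      have hL : L = 0 := by
        refine ContinuousLinearMap.ext_on (s := Set.range b) ?_ ?_
        · rw [dense_iff_closure_eq, ← Submodule.topologicalClosure_coe, b.dense_span]; rfl
        · intro y hy
          refine ih _ fun i hi => ?_
          by_cases hij : i = j
          · subst hij; simpa using hy
          · rw [Function.update_of_ne hij]
            exact hv i (by simp [hij, hi])
      have := DFunLike.congr_fun hL (v j)
      change ⟪x, tprod (Function.update v j (v j))⟫_ℂ = 0 at this
      rwa [Function.update_eq_self] at this
  exact ext_inner_tprod fun v => by
    rw [key Finset.univ v fun j hj => absurd (Finset.mem_univ j) hj, inner_zero_left]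

/-- The product basis of the Hilbert tensor power. -/
noncomputable def tensorBasis (b : HilbertBasis ι ℂ H) (m : ℕ) :
    HilbertBasis (Fin m → ι) ℂ (TensorPow H m) :=
  HilbertBasis.mkOfOrthogonalEqBot (orthonormal_tprod b.orthonormal m) (orthogonal_span_tprod b m)

theorem tensorBasis_apply (b : HilbertBasis ι ℂ H) (m : ℕ) (α : Fin m → ι) :
    tensorBasis b m α = tprod fun j => b (α j) := by
  rw [tensorBasis, HilbertBasis.coe_mkOfOrthogonalEqBot]

/-- This is `∑_α V_α V_α* = 1`: Parseval in the product basis, grouped by the last `m` indices. -/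
theorem hasSum_norm_adjoint_append_sq (b : HilbertBasis ι ℂ H) (k m : ℕ)
    (y : TensorPow H (k + m)) :
    HasSum (fun α : Fin m → ι => ‖(append k fun j => b (α j)).adjoint y‖ ^ 2) (‖y‖ ^ 2) := by
  have h := hasSum_norm_inner_sq (tensorBasis b (k + m)) y
  rw [← (Fin.appendEquiv (α := ι) k m).hasSum_iff,
    ← (Equiv.prodComm (Fin m → ι) (Fin k → ι)).hasSum_iff] at h
  refine h.prod_fiberwise fun α => ?_
  convert hasSum_norm_inner_sq (tensorBasis b k) ((append k fun j => b (α j)).adjoint y) using 3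
    with β
  rw [tensorBasis_apply, ContinuousLinearMap.adjoint_inner_right, append_tprod]
  simp only [Function.comp_apply, tensorBasis_apply, Equiv.prodComm_apply, Prod.swap]
  congr 3
  refine congrArg tprod (funext fun i => ?_)
  refine Fin.addCases (fun j => ?_) (fun j => ?_) i <;> simp [Fin.appendEquiv]

end ProductBasis

/-! ### Reduced density matrices as expectation values -/

section States

variable {H : Type*} [NormedAddCommGroup H] [InnerProductSpace ℂ H]

/-- With `Γ = S²` and `S` Hilbert–Schmidt of norm one, expectations become absolutely convergent
sums `∑ ⟨S e_i, D S e_i⟩`. -/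
theorem IsBosonicState.exists_sqrt {N : ℕ} {Γ : SymPow H N →L[ℂ] SymPow H N}
    (h : IsBosonicState Γ) : ∃ S : SymPow H N →L[ℂ] SymPow H N, S.adjoint = S ∧ S ∘L S = Γ ∧
      HasSum (fun i => ‖S (someBasis (SymPow H N) i)‖ ^ 2) 1 := by
  have h0 : 0 ≤ Γ := (ContinuousLinearMap.nonneg_iff_isPositive Γ).mpr h.isPositive
  obtain ⟨S, hS, hSS⟩ : ∃ S : SymPow H N →L[ℂ] SymPow H N, S.adjoint = S ∧ S ∘L S = Γ :=
    ⟨CFC.sqrt Γ, ((ContinuousLinearMap.nonneg_iff_isPositive _).mp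
      (CFC.sqrt_nonneg Γ)).isSelfAdjoint, CFC.sqrt_mul_sqrt_self Γ h0⟩
  refine ⟨S, hS, hSS, ?_⟩
  have e : ∀ i, ⟪someBasis (SymPow H N) i, Γ (someBasis (SymPow H N) i)⟫_ℂ
      = ((‖S (someBasis (SymPow H N) i)‖ ^ 2 : ℝ) : ℂ) := by
    intro i
    rw [← hSS, ContinuousLinearMap.comp_apply, ← ContinuousLinearMap.adjoint_inner_left, hS,
      inner_self_eq_norm_sq_to_K]
    simp
  have h1 := h.isTraceClass
  have h2 := h.trace_eq_one
  unfold IsTraceClass at h1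
  rw [CFC.abs_of_nonneg Γ h0] at h1
  unfold trace at h2
  simp only [e, Complex.ofReal_re] at h1 h2
  rw [← Complex.ofReal_tsum] at h2
  have h3 : ∑' i, ‖S (someBasis (SymPow H N) i)‖ ^ 2 = 1 := by exact_mod_cast h2
  exact h3 ▸ h1.hasSum

/-- The identification of bosonic spaces of equal particle number. -/
noncomputable def castSym {n n' : ℕ} (h : n = n') : SymPow H n →L[ℂ] SymPow H n' :=
  h ▸ ContinuousLinearMap.id ℂ (SymPow H n)

theorem castSym_symTprod {n n' : ℕ} (h : n = n') (v : Fin n → H) :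
    castSym h (symTprod v) = symTprod fun i => v (Fin.cast h.symm i) := by
  subst h; rfl

theorem norm_oneBody_pow_sub_castSym {n n' : ℕ} (h : n = n') (f g : H) (k : ℕ)
    (D : SymPow H n →L[ℂ] SymPow H n) :
    ‖oneBody f g n' ^ k - castSym h ∘L D ∘L (castSym (H := H) h).adjoint‖
      = ‖oneBody f g n ^ k - D‖ := by
  subst h
  simp only [castSym, ContinuousLinearMap.adjoint_id, ContinuousLinearMap.id_comp]
  rfl

theorem symTprod_append_comm {k m : ℕ} (v : Fin k → H) (w : Fin m → H) :
    symTprod (Fin.append v w)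
      = castSym (Nat.add_comm m k) (symTprod (Fin.append w v)) := by
  rw [castSym_symTprod, ← symTprod_perm (fun i => Fin.append w v (Fin.cast _ i))
    (finAddFlip.trans (finCongr (Nat.add_comm m k)))]
  congr 1
  funext i
  refine Fin.addCases (fun j => ?_) (fun j => ?_) i <;> simp

/-- The symmetrized tensor product with `f^{⊗ k}` from the left. -/
noncomputable def createPow' (f : H) (k m : ℕ) : SymPow H m →L[ℂ] SymPow H (k + m) :=
  castSym (Nat.add_comm m k) ∘L createPow f m k

variable [CompleteSpace H]

/-- The matrix element is the expectation in `Γ` of `C_f^k (C_g^k)*`. Symmetrizing `f^{⊗k} ⊗ e_α`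
amounts to applying the creation power to the symmetrization of `e_α`; the sum over the product
basis `e_α` is then moved to the basis `e_i` by cyclicity of the trace. -/
theorem inner_powTensor_reducedDensityMatrix {k m : ℕ}
    {Γ S : SymPow H (k + m) →L[ℂ] SymPow H (k + m)} (hS : S.adjoint = S) (hSS : S ∘L S = Γ)
    (hsum : Summable fun i => ‖S (someBasis (SymPow H (k + m)) i)‖ ^ 2) (f g : H) :
    ⟪powTensor g k, reducedDensityMatrix k m Γ (powTensor f k)⟫_ℂ
      = ∑' i, ⟪S (someBasis _ i),
          (createPow' f k m ∘L (createPow' g k m).adjoint) (S (someBasis _ i))⟫_ℂ := by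
  set e := someBasis (SymPow H (k + m))
  set J := symIncl H (k + m)
  let V : (Fin m → basisIndex H) → TensorPow H k →L[ℂ] TensorPow H (k + m) :=
    fun α => append k fun j => someBasis H (α j)
  have hterm : ∀ α, (V α).adjoint ∘L (J ∘L Γ ∘L J.adjoint) ∘L V α
      = (S ∘L J.adjoint ∘L V α).adjoint ∘L (S ∘L J.adjoint ∘L V α) := by
    intro α
    rw [ContinuousLinearMap.adjoint_comp, ContinuousLinearMap.adjoint_comp,
      ContinuousLinearMap.adjoint_adjoint, hS, ← hSS]
    rfl
  have hadj : ∀ α i, (S ∘L J.adjoint ∘L V α).adjoint (e i) = (V α).adjoint (J (S (e i))) := by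
    intro α i
    rw [ContinuousLinearMap.adjoint_comp, ContinuousLinearMap.adjoint_comp,
      ContinuousLinearMap.adjoint_adjoint, hS]
    rfl
  have hprod : Summable fun p : basisIndex (SymPow H (k + m)) × (Fin m → basisIndex H) =>
      ‖(V p.2).adjoint (J (S (e p.1)))‖ ^ 2 := by
    refine (summable_prod_of_nonneg fun p => sq_nonneg _).mpr ⟨fun i => ?_, ?_⟩
    · exact (hasSum_norm_adjoint_append_sq (someBasis H) k m (J (S (e i)))).summable
    · simp only [V, (hasSum_norm_adjoint_append_sq (someBasis H) k m _).tsum_eq]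
      exact hsum
  have hprod' := (summable_prod_of_nonneg fun p => sq_nonneg _).mp hprod.prod_symm
  -- The partial trace converges in operator norm: each term is `A*A`, bounded by the squared
  -- Hilbert–Schmidt norm of `A`, and these bounds add up to `∑ ‖S e_i‖²`. A bounded functional may
  -- then be taken through the sum.
  have hsummable : Summable fun α => (V α).adjoint ∘L (J ∘L Γ ∘L J.adjoint) ∘L V α := by
    refine Summable.of_norm_bounded hprod'.2 fun α => ?_
    rw [hterm, ContinuousLinearMap.norm_adjoint_comp_self, ← sq]
    refine (norm_sq_le_tsum_adjoint e _ ?_).trans (le_of_eq ?_)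
    · simp only [hadj]
      exact hprod'.1 α
    · simp only [hadj]
      rfl
  have h1 : ⟪powTensor g k, reducedDensityMatrix k m Γ (powTensor f k)⟫_ℂ
      = ∑' α, ⟪S (J.adjoint (V α (symIncl H k (powTensor g k)))),
          S (J.adjoint (V α (symIncl H k (powTensor f k))))⟫_ℂ := by
    unfold reducedDensityMatrix
    rw [ContinuousLinearMap.comp_apply, ContinuousLinearMap.adjoint_inner_right,
      ContinuousLinearMap.comp_apply]
    have h2 := ContinuousLinearMap.map_tsum ((innerSL ℂ (symIncl H k (powTensor g k))) ∘L
      (ContinuousLinearMap.apply ℂ (TensorPow H k) (symIncl H k (powTensor f k)))) hsummable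
    refine h2.trans (tsum_congr fun α => ?_)
    rw [hterm]
    exact ContinuousLinearMap.adjoint_inner_right (S ∘L J.adjoint ∘L V α) _ _
  have h3 : ∀ (f : H) α, S (J.adjoint (V α (symIncl H k (powTensor f k))))
      = (S ∘L createPow' f k m ∘L (symIncl H m).adjoint) (tensorBasis (someBasis H) m α) := by
    intro f α
    rw [symIncl_powTensor, append_tprod, tensorBasis_apply]
    change S (symTprod _) = S (castSym _ (createPow f m k (symTprod _)))
    rw [createPow_symTprod, symTprod_append_comm]
  have h4 : ∀ (f : H) i, (S ∘L createPow' f k m ∘L (symIncl H m).adjoint).adjoint (e i)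
      = symIncl H m ((createPow' f k m).adjoint (S (e i))) := by
    intro f i
    rw [ContinuousLinearMap.adjoint_comp, ContinuousLinearMap.adjoint_comp,
      ContinuousLinearMap.adjoint_adjoint, hS]
    rfl
  have h5 : ∀ f : H, Summable fun i =>
      ‖(S ∘L createPow' f k m ∘L (symIncl H m).adjoint).adjoint (e i)‖ ^ 2 := by
    intro f
    refine Summable.of_nonneg_of_le (fun i => sq_nonneg _) (fun i => ?_)
      (hsum.mul_left (‖(createPow' f k m).adjoint‖ ^ 2))
    rw [h4, ← mul_pow]
    exact pow_le_pow_left₀ (norm_nonneg _) ((createPow' f k m).adjoint.le_opNorm _) 2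
  rw [h1]
  simp only [h3]
  rw [tsum_inner_eq_tsum_inner_adjoint (tensorBasis (someBasis H) m) e _ _ (h5 g) (h5 f)]
  refine tsum_congr fun i => ?_
  rw [h4, h4, inner_symIncl, ContinuousLinearMap.adjoint_inner_left]
  rfl

end States

/-! ### Limits of states and commutative representations -/

section LimitState

open scoped ENNReal ComplexOrder

universe u

noncomputable instance lpInftyCStarAlgebra {I : Type*} {A : I → Type*} [∀ i, Nontrivial (A i)]
    [∀ i, CStarAlgebra (A i)] : CStarAlgebra (lp A ∞) where

variable {B : ℕ → Type u} [∀ N, Nontrivial (B N)] [∀ N, CStarAlgebra (B N)]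

/-- An ultrafilter limit of states along a sequence of C*-algebras. -/
theorem exists_limit_functional (φ : ∀ N, B N →ₗ[ℂ] ℂ) (hφ : ∀ N x, ‖φ N x‖ ≤ ‖x‖) :
    ∃ ω : lp B ∞ →ₗ[ℂ] ℂ, ∀ x : lp B ∞,
      Tendsto (fun N => φ N (x N)) (hyperfilter ℕ : Filter ℕ) (𝓝 (ω x)) := by
  have h : ∀ x : lp B ∞, ∃ z, Tendsto (fun N => φ N (x N)) (hyperfilter ℕ : Filter ℕ) (𝓝 z) := by
    intro x
    have hc := (isCompact_closedBall (0 : ℂ) ‖x‖).ultrafilter_le_nhds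
      ((hyperfilter ℕ).map fun N => φ N (x N)) (by
        rw [le_principal_iff, Ultrafilter.mem_coe, Ultrafilter.mem_map]
        refine univ_mem' fun N => ?_
        rw [Set.mem_preimage, mem_closedBall_zero_iff]
        exact (hφ N _).trans (lp.norm_apply_le_norm ENNReal.top_ne_zero x N))
    obtain ⟨z, -, hz⟩ := hc
    exact ⟨z, hz⟩
  choose ω hω using h
  refine ⟨{ toFun := ω, map_add' := fun x y => ?_, map_smul' := fun c x => ?_ }, hω⟩
  · refine tendsto_nhds_unique (hω (x + y)) (((hω x).add (hω y)).congr fun N => ?_)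
    rw [lp.coeFn_add, Pi.add_apply, map_add]
  · refine tendsto_nhds_unique (hω (c • x)) (((hω x).const_smul c).congr fun N => ?_)
    rw [lp.coeFn_smul, Pi.smul_apply, map_smul]

/-- The GNS construction, for a positive linear functional on a unital C*-algebra. -/
theorem exists_gns {D : Type u} [CStarAlgebra D] (ω : D →ₗ[ℂ] ℂ)
    (hω0 : ∀ x, 0 ≤ ω (star x * x)) :
    ∃ (K : Type u) (_ : NormedAddCommGroup K) (_ : InnerProductSpace ℂ K) (_ : CompleteSpace K)
      (π : D →⋆ₐ[ℂ] (K →L[ℂ] K)) (Ω : K),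
      (∀ x, (∀ y, ω (star (x * y) * (x * y)) = 0) → π x = 0) ∧ ∀ x, ⟪Ω, π x Ω⟫_ℂ = ω x := by
  let _ : PartialOrder D := CStarAlgebra.spectralOrder _
  have _ : StarOrderedRing D := CStarAlgebra.spectralOrderedRing _
  let f : D →ₚ[ℂ] ℂ := PositiveLinearMap.mk₀ ω fun a ha => by
    obtain ⟨b, rfl⟩ := CStarAlgebra.nonneg_iff_eq_star_mul_self.mp ha
    exact hω0 b
  have hf : ∀ a, f a = ω a := fun a => rfl
  refine ⟨f.GNS, inferInstance, inferInstance, inferInstance, f.gnsStarAlgHom,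
    ((f.toPreGNS 1 : f.PreGNS) : f.GNS), fun x hx => ?_, fun x => ?_⟩
  · refine ContinuousLinearMap.ext fun y => ?_
    refine UniformSpace.Completion.induction_on (α := f.PreGNS) y
      (isClosed_eq (ContinuousLinearMap.continuous _) (ContinuousLinearMap.continuous _))
      fun b => ?_
    have h1 : f.gnsStarAlgHom x (b : f.GNS)
        = ((f.toPreGNS (x * f.ofPreGNS b) : f.PreGNS) : f.GNS) := by
      simp
    rw [h1, zero_apply, ← norm_eq_zero, UniformSpace.Completion.norm_coe, ← sq_eq_zero_iff]
    have h2 := f.preGNS_norm_sq (f.toPreGNS (x * f.ofPreGNS b))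
    rw [PositiveLinearMap.ofPreGNS_toPreGNS, hf, hx] at h2
    exact_mod_cast h2
  · have h1 : f.gnsStarAlgHom x ((f.toPreGNS 1 : f.PreGNS) : f.GNS)
        = ((f.toPreGNS x : f.PreGNS) : f.GNS) := by
      simp
    rw [h1, UniformSpace.Completion.inner_coe, f.preGNS_inner_def]
    simp only [PositiveLinearMap.ofPreGNS_toPreGNS, star_one, one_mul, hf]

/-- The GNS representation of a limit state annihilates null sequences. -/
theorem exists_representation_of_states (φ : ∀ N, B N →ₗ[ℂ] ℂ) (hφ : ∀ N x, ‖φ N x‖ ≤ ‖x‖)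
    (hpos : ∀ N x, 0 ≤ φ N (star x * x)) :
    ∃ (K : Type u) (_ : NormedAddCommGroup K) (_ : InnerProductSpace ℂ K) (_ : CompleteSpace K)
      (π : lp B ∞ →⋆ₐ[ℂ] (K →L[ℂ] K)) (Ω : K),
      (∀ x : lp B ∞, Tendsto (fun N => ‖x N‖) atTop (𝓝 0) → π x = 0) ∧
      (∀ (x : lp B ∞) (z : ℂ), Tendsto (fun N => φ N (x N)) atTop (𝓝 z) →
        ⟪Ω, π x Ω⟫_ℂ = z) := by
  obtain ⟨ω, hω⟩ := exists_limit_functional φ hφ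
  have hω0 : ∀ x : lp B ∞, 0 ≤ ω (star x * x) := by
    intro x
    refine ge_of_tendsto (hω (star x * x)) (Eventually.of_forall fun N => ?_)
    rw [lp.infty_coeFn_mul, Pi.mul_apply, lp.coeFn_star, Pi.star_apply]
    exact hpos N _
  obtain ⟨K, i1, i2, i3, π, Ω, h1, h2⟩ := exists_gns ω hω0
  refine ⟨K, i1, i2, i3, π, Ω, fun x hx => h1 x fun b => ?_, fun x z hz => ?_⟩
  -- Each state is bounded by the norm, so a null sequence times any bounded sequence has vanishing
  -- GNS seminorm.
  · refine tendsto_nhds_unique (hω _) (Tendsto.mono_left ?_ Nat.hyperfilter_le_atTop)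
    refine squeeze_zero_norm (a := fun N => (‖x N‖ * ‖b‖) ^ 2) (fun N => ?_) ?_
    · refine (hφ N _).trans ?_
      rw [lp.infty_coeFn_mul, Pi.mul_apply, lp.coeFn_star, Pi.star_apply,
        CStarRing.norm_star_mul_self, ← sq]
      refine pow_le_pow_left₀ (norm_nonneg _) ?_ 2
      rw [lp.infty_coeFn_mul, Pi.mul_apply]
      refine (norm_mul_le _ _).trans (mul_le_mul_of_nonneg_left ?_ (norm_nonneg _))
      exact lp.norm_apply_le_norm ENNReal.top_ne_zero _ N
    · simpa using (hx.mul_const ‖b‖).pow 2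
  · rw [h2]
    exact tendsto_nhds_unique (hω x) (hz.mono_left Nat.hyperfilter_le_atTop)

end LimitState

/-! ### States on commutative C*-algebras as probability measures -/

section Commutative

open scoped ComplexOrder

universe u

/-- The Riesz–Markov–Kakutani theorem for states on the complex continuous functions. -/
theorem exists_measure_of_state {X : Type*} [TopologicalSpace X] [CompactSpace X] [T2Space X]
    [MeasurableSpace X] [BorelSpace X] (ω : C(X, ℂ) →ₗ[ℂ] ℂ)
    (hpos : ∀ a, 0 ≤ ω (star a * a)) (h1 : ω 1 = 1) :
    ∃ ν : Measure X, IsProbabilityMeasure ν ∧ ∀ g, ω g = ∫ x, g x ∂ν := by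
  let toC : C(X, ℝ) → C(X, ℂ) := fun h => ⟨fun x => (h x : ℂ), by fun_prop⟩
  have hre : ∀ h : C(X, ℝ), 0 ≤ h → 0 ≤ ω (toC h) := by
    intro h hh
    let s : C(X, ℝ) := ⟨fun x => Real.sqrt (h x), by fun_prop⟩
    have : toC h = star (toC s) * toC s := by
      ext x
      have := Real.mul_self_sqrt (hh x)
      simp only [toC, s, ContinuousMap.mul_apply, ContinuousMap.star_apply,
        ContinuousMap.coe_mk, Complex.star_def, Complex.conj_ofReal]
      exact_mod_cast this.symm
    rw [this]
    exact hpos _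
  have hadd : ∀ g h, toC (g + h) = toC g + toC h := fun g h => by ext; simp [toC]
  have hsmul : ∀ (c : ℝ) h, toC (c • h) = (c : ℂ) • toC h := fun c h => by ext; simp [toC]
  let Λ : CompactlySupportedContinuousMap X ℝ →ₚ[ℝ] ℝ := PositiveLinearMap.mk₀
    { toFun := fun h => (ω (toC h.toContinuousMap)).re
      map_add' := fun g h => by
        rw [show (g + h).toContinuousMap = g.toContinuousMap + h.toContinuousMap from rfl, hadd,
          map_add, Complex.add_re]
      map_smul' := fun c h => by
        rw [show (c • h).toContinuousMap = c • h.toContinuousMap from rfl, hsmul,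
          map_smul, smul_eq_mul, Complex.re_ofReal_mul]
        rfl }
    fun h hh => (Complex.le_def.mp (hre h.toContinuousMap fun x => hh x)).1
  have hΛ : ∀ h : C(X, ℝ), ω (toC h) = ((∫ x, h x ∂(RealRMK.rieszMeasure Λ) : ℝ) : ℂ) := by
    intro h
    have him : (ω (toC h)).im = 0 := by
      have hdec : ∀ x, h x = max (h x) 0 - max (-h x) 0 := by
        intro x
        rcases le_total (h x) 0 with hx | hx
        · rw [max_eq_right hx, max_eq_left (by linarith)]; ring
        · rw [max_eq_left hx, max_eq_right (by linarith)]; ring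
      have hsub : toC h = toC (h ⊔ 0) - toC (-h ⊔ 0) := by
        ext x
        change (h x : ℂ) = ((max (h x) 0 : ℝ) : ℂ) - ((max (-h x) 0 : ℝ) : ℂ)
        exact_mod_cast hdec x
      rw [hsub, map_sub, Complex.sub_im,
        ← (Complex.le_def.mp (hre (h ⊔ 0) le_sup_right)).2,
        ← (Complex.le_def.mp (hre (-h ⊔ 0) le_sup_right)).2]
      simp
    have hint := RealRMK.integral_rieszMeasure Λ
      (⟨h, HasCompactSupport.of_compactSpace _⟩ : CompactlySupportedContinuousMap X ℝ)
    refine Complex.ext ?_ ?_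
    · rw [Complex.ofReal_re]
      exact hint.symm
    · rw [Complex.ofReal_im, him]
  refine ⟨RealRMK.rieszMeasure Λ, ⟨?_⟩, fun g => ?_⟩
  · have hone := hΛ 1
    have : toC 1 = 1 := by ext; simp [toC]
    rw [this, h1] at hone
    simp only [ContinuousMap.one_apply, integral_const, smul_eq_mul, mul_one] at hone
    have h2 : (RealRMK.rieszMeasure Λ).real Set.univ = 1 := by exact_mod_cast hone.symm
    rw [← ENNReal.toReal_eq_one_iff]
    exact h2
  · let r : C(X, ℝ) := ⟨fun x => (g x).re, by fun_prop⟩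
    let i : C(X, ℝ) := ⟨fun x => (g x).im, by fun_prop⟩
    have hgi : g = toC r + Complex.I • toC i := by
      ext x
      simp only [toC, r, i, ContinuousMap.add_apply, ContinuousMap.smul_apply,
        ContinuousMap.coe_mk, smul_eq_mul]
      rw [mul_comm, Complex.re_add_im]
    have hgint : Integrable (fun x => g x) (RealRMK.rieszMeasure Λ) :=
      (BoundedContinuousFunction.mkOfCompact g).integrable _
    have e : ω g = ω (toC r) + Complex.I * ω (toC i) := by
      conv_lhs => rw [hgi, map_add, map_smul, smul_eq_mul]
    rw [e, hΛ, hΛ, mul_comm]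
    exact integral_re_add_im hgint

/-- A commuting self-adjoint family in a C*-algebra, together with a state, is represented by
continuous functions on a compact probability space. -/
theorem exists_gelfand_model {D : Type u} [CStarAlgebra D] (S : Set D)
    (hcomm : ∀ x ∈ S, ∀ y ∈ S, x * y = y * x) (hstar : ∀ x ∈ S, star x ∈ S) (ω : D →ₗ[ℂ] ℂ)
    (hpos : ∀ a, 0 ≤ ω (star a * a)) (h1 : ω 1 = 1) :
    ∃ (X : Type u) (_ : TopologicalSpace X) (_ : CompactSpace X)
      (_ : MeasurableSpace X) (_ : BorelSpace X) (ν : Measure X) (_ : IsProbabilityMeasure ν)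
      (ev : (StarAlgebra.adjoin ℂ S).topologicalClosure →⋆ₐ[ℂ] C(X, ℂ)),
      (∀ a x, ‖ev a x‖ ≤ ‖(a : D)‖) ∧
      ∀ a : (StarAlgebra.adjoin ℂ S).topologicalClosure, ω a = ∫ x, ev a x ∂ν := by
  set C := (StarAlgebra.adjoin ℂ S).topologicalClosure
  have hcl : IsClosed (C : Set D) := StarSubalgebra.isClosed_topologicalClosure _
  -- Closure of `S` under `star` makes the generated star algebra commutative, so Gelfand duality
  -- applies to its closure.
  have hC : IsMulCommutative (StarAlgebra.adjoin ℂ S) :=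
    StarAlgebra.isMulCommutative_adjoin ℂ hcomm fun x hx y hy => hcomm x hx _ (hstar y hy)
  let i1 : CStarAlgebra C := StarSubalgebra.cstarAlgebra C (h_closed := hcl)
  have hmul : ∀ x y : C, x * y = y * x :=
    (StarSubalgebra.commRingTopologicalClosure (StarAlgebra.adjoin ℂ S)
      fun x y => hC.is_comm.comm x y).mul_comm
  let i2 : CommCStarAlgebra C := { i1 with mul_comm := hmul }
  let _ : MeasurableSpace (WeakDual.characterSpace ℂ C) := borel _
  have _ : BorelSpace (WeakDual.characterSpace ℂ C) := ⟨rfl⟩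
  let e : C ≃⋆ₐ[ℂ] C(WeakDual.characterSpace ℂ C, ℂ) := gelfandStarTransform C
  obtain ⟨ν, hν, h⟩ := exists_measure_of_state
    (ω ∘ₗ C.subtype.toLinearMap ∘ₗ e.symm.toAlgEquiv.toLinearMap)
    (fun a => by
      have := hpos (e.symm a : C)
      change 0 ≤ ω ((e.symm (star a * a) : C) : D)
      rw [map_mul, map_star]
      exact this)
    (by
      change ω ((e.symm 1 : C) : D) = 1
      rw [map_one]
      exact h1)
  let ev : C →⋆ₐ[ℂ] C(WeakDual.characterSpace ℂ C, ℂ) := e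
  refine ⟨WeakDual.characterSpace ℂ C, inferInstance, inferInstance, inferInstance,
    inferInstance, ν, hν, ev, fun a x => ?_, fun a => ?_⟩
  · exact (ContinuousMap.norm_coe_le_norm (ev a) x).trans
      (NonUnitalStarAlgHom.norm_apply_le _ a)
  · rw [show (ω a : ℂ) = ω (e.symm (e a) : C) by rw [e.symm_apply_apply]]
    exact h (e a)

end Commutative

/-! ### The limiting commutative model of a sequence of bosonic states -/

section Expectation

open scoped ComplexOrder

variable {E : Type*} [NormedAddCommGroup E] [InnerProductSpace ℂ E] {κ : Type*}

theorem norm_inner_apply_le (D : E →L[ℂ] E) (x : E) : ‖⟪x, D x⟫_ℂ‖ ≤ ‖D‖ * ‖x‖ ^ 2 :=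
  calc ‖⟪x, D x⟫_ℂ‖ ≤ ‖x‖ * ‖D x‖ := norm_inner_le_norm _ _
    _ ≤ ‖x‖ * (‖D‖ * ‖x‖) := mul_le_mul_of_nonneg_left (D.le_opNorm x) (norm_nonneg _)
    _ = ‖D‖ * ‖x‖ ^ 2 := by ring

theorem summable_inner_apply {w : κ → E} (hw : Summable fun i => ‖w i‖ ^ 2) (D : E →L[ℂ] E) :
    Summable fun i => ⟪w i, D (w i)⟫_ℂ :=
  Summable.of_norm_bounded (hw.mul_left ‖D‖) fun i => norm_inner_apply_le D (w i)

/-- The functional `D ↦ ∑ᵢ ⟨wᵢ, D wᵢ⟩`. -/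
noncomputable def expectation (w : κ → E) (hw : Summable fun i => ‖w i‖ ^ 2) :
    (E →L[ℂ] E) →ₗ[ℂ] ℂ where
  toFun D := ∑' i, ⟪w i, D (w i)⟫_ℂ
  map_add' D D' := by
    simp only [add_apply, inner_add_right]
    exact (summable_inner_apply hw D).tsum_add (summable_inner_apply hw D')
  map_smul' c D := by
    simp only [smul_apply, inner_smul_right, RingHom.id_apply, smul_eq_mul]
    exact tsum_mul_left

theorem expectation_apply (w : κ → E) (hw : Summable fun i => ‖w i‖ ^ 2) (D : E →L[ℂ] E) :
    expectation w hw D = ∑' i, ⟪w i, D (w i)⟫_ℂ := rfl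

theorem norm_expectation_le {w : κ → E} (hw : HasSum (fun i => ‖w i‖ ^ 2) 1) (D : E →L[ℂ] E) :
    ‖expectation w hw.summable D‖ ≤ ‖D‖ := by
  refine tsum_of_norm_bounded ?_ fun i => norm_inner_apply_le D (w i)
  simpa using hw.mul_left ‖D‖

theorem expectation_one {w : κ → E} (hw : HasSum (fun i => ‖w i‖ ^ 2) 1) :
    expectation w hw.summable 1 = 1 := by
  have h := (Complex.hasSum_ofReal.mpr hw).tsum_eq
  rw [Complex.ofReal_one] at h
  rw [← h, expectation_apply]
  refine tsum_congr fun i => ?_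
  rw [one_apply_eq_self, inner_self_eq_norm_sq_to_K]
  simp

theorem expectation_star_mul_self_nonneg [CompleteSpace E] (w : κ → E)
    (hw : Summable fun i => ‖w i‖ ^ 2) (D : E →L[ℂ] E) :
    0 ≤ expectation w hw (star D * D) := by
  rw [expectation_apply]
  refine tsum_nonneg fun i => ?_
  rw [mul_apply_eq_comp, ContinuousLinearMap.star_eq_adjoint,
    ContinuousLinearMap.adjoint_inner_right, inner_self_eq_norm_sq_to_K, ← RCLike.ofReal_pow]
  exact Complex.zero_le_real.mpr (sq_nonneg _)

/-- Rank-one operators are the compact test operators that turn weak-`*` convergence into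
convergence of matrix elements. -/
theorem trace_comp_rankOne [CompleteSpace E] (A : E →L[ℂ] E) (x y : E) :
    trace (A ∘L InnerProductSpace.rankOne ℂ x y) = ⟪y, A x⟫_ℂ := by
  unfold trace
  rw [← (someBasis E).tsum_inner_mul_inner]
  refine tsum_congr fun i => ?_
  rw [ContinuousLinearMap.comp_apply, InnerProductSpace.rankOne_apply, map_smul, inner_smul_right]

theorem isCompactOperator_rankOne (x y : E) :
    IsCompactOperator (InnerProductSpace.rankOne ℂ x y) := by
  have h : IsCompactOperator (innerSL ℂ y) := by
    have := (isCompactOperator_id_iff_finiteDimensional (𝕜 := ℂ) (E := ℂ)).mpr inferInstance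
    exact this.comp_clm (innerSL ℂ y)
  exact h.clm_comp (ContinuousLinearMap.toSpanSingleton ℂ x)

end Expectation

/-! ### Passage from one-body operators to commuting random variables -/

section Model

universe u

variable {H : Type u} [NormedAddCommGroup H] [InnerProductSpace ℂ H]

open scoped ENNReal in
/-- The sequence of one-body operators, as an element of the product C*-algebra. -/
noncomputable def oneBodySeq (f g : H) : lp (fun N => SymPow H N →L[ℂ] SymPow H N) ∞ :=
  ⟨fun N => oneBody f g N, memℓp_infty ⟨‖f‖ * ‖g‖, by
    rintro _ ⟨N, rfl⟩
    exact norm_oneBody_le f g N⟩⟩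

theorem oneBodySeq_apply (f g : H) (N : ℕ) : oneBodySeq f g N = oneBody f g N := rfl

theorem tendsto_zero_of_norm_succ_le {a : ℕ → ℝ} {C : ℝ} (h0 : ∀ N, 0 ≤ a N)
    (h : ∀ N : ℕ, a (N + 1) ≤ C / (N + 1)) : Tendsto a atTop (𝓝 0) := by
  rw [← tendsto_add_atTop_iff_nat 1]
  refine squeeze_zero (fun N => h0 _) h ?_
  exact tendsto_const_div_atTop_nhds_zero_nat C |>.comp (tendsto_add_atTop_nat 1) |>.congr
    fun m => by simp

variable [CompleteSpace H]

/-- The moments of the one-body operators converge to the matrix elements of the limiting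
density matrices. -/
theorem tendsto_expectation_oneBody_pow
    {Γ S : ∀ N : ℕ, SymPow H N →L[ℂ] SymPow H N} (hS : ∀ N, (S N).adjoint = S N)
    (hSS : ∀ N, S N ∘L S N = Γ N)
    (hsum : ∀ N, HasSum (fun i => ‖S N (someBasis (SymPow H N) i)‖ ^ 2) 1)
    {k : ℕ} {γ : SymPow H k →L[ℂ] SymPow H k}
    (hconv : TendstoWeakStar (fun m : ℕ => reducedDensityMatrix k m (Γ (k + m))) atTop γ)
    (f g : H) :
    Tendsto (fun N => expectation _ (hsum N).summable (oneBody f g N ^ k)) atTop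
      (𝓝 ⟪powTensor g k, γ (powTensor f k)⟫_ℂ) := by
  rw [← tendsto_add_atTop_iff_nat k]
  have h1 := hconv _ (isCompactOperator_rankOne (powTensor f k) (powTensor g k))
  simp only [trace_comp_rankOne] at h1
  obtain ⟨C, hC⟩ := exists_norm_oneBody_pow_sub_le f g k
  have h2 : Tendsto (fun m : ℕ => C / ((m : ℝ) + 1)) atTop (𝓝 0) :=
    tendsto_const_div_atTop_nhds_zero_nat C |>.comp (tendsto_add_atTop_nat 1) |>.congr
      fun m => by simp
  -- Normal ordering of the `k`-th power costs `O(1/m)` in norm, hence also in every state.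
  have h3 : Tendsto (fun m => expectation _ (hsum (k + m)).summable
      (oneBody f g (k + m) ^ k - createPow' f k m ∘L (createPow' g k m).adjoint)) atTop (𝓝 0) := by
    refine squeeze_zero_norm (fun m => (norm_expectation_le (hsum (k + m)) _).trans ?_) h2
    refine le_trans (le_of_eq ?_) (hC m)
    rw [← norm_oneBody_pow_sub_castSym (Nat.add_comm m k)]
    unfold createPow'
    rw [ContinuousLinearMap.adjoint_comp]
    rfl
  have h4 := h3.add h1
  rw [zero_add] at h4
  refine h4.congr fun m => ?_
  rw [inner_powTensor_reducedDensityMatrix (hS _) (hSS _) (hsum _).summable, map_sub,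
    expectation_apply _ _ (createPow' f k m ∘L (createPow' g k m).adjoint), sub_add_cancel,
    Nat.add_comm k m]

/-- `Z f g` is the Gelfand transform of the GNS image of the sequence `oneBody f g N`. Relations
with `O(1/N)` errors hold exactly there because null sequences are annihilated. -/
theorem exists_classical_model
    (Γ : ∀ N : ℕ, SymPow H N →L[ℂ] SymPow H N) (hΓ : ∀ N, IsBosonicState (Γ N))
    (γ : ∀ k : ℕ, SymPow H k →L[ℂ] SymPow H k)
    (hconv : ∀ k : ℕ, TendstoWeakStar
      (fun m : ℕ => reducedDensityMatrix k m (Γ (k + m))) atTop (γ k)) :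
    ∃ (X : Type u) (_ : TopologicalSpace X) (_ : CompactSpace X)
      (_ : MeasurableSpace X) (_ : BorelSpace X) (ν : Measure X) (_ : IsProbabilityMeasure ν)
      (Z : H → H → C(X, ℂ)),
      (∀ f f' g, Z (f + f') g = Z f g + Z f' g) ∧ (∀ (c : ℂ) f g, Z (c • f) g = c • Z f g) ∧
      (∀ f g, star (Z f g) = Z g f) ∧ (∀ f g f' g', Z f g * Z f' g' = Z f g' * Z f' g) ∧
      (∀ f g x, ‖Z f g x‖ ≤ ‖f‖ * ‖g‖) ∧
      (∀ f x, ‖((‖f‖ ^ 2 : ℝ) : ℂ) - Z f f x‖ ≤ ‖f‖ ^ 2) ∧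
      ∀ k f g, ∫ x, Z f g x ^ k ∂ν = ⟪powTensor g k, γ k (powTensor f k)⟫_ℂ := by
  choose S hS hSS hsum using fun N => (hΓ N).exists_sqrt
  -- On a zero space `1 = 0`, which contradicts trace one.
  have hnt : ∀ N, Nontrivial (SymPow H N →L[ℂ] SymPow H N) := by
    intro N
    by_contra hN
    rw [not_nontrivial_iff_subsingleton] at hN
    have h1 := expectation_one (hsum N)
    rw [Subsingleton.elim (1 : SymPow H N →L[ℂ] SymPow H N) 0, map_zero] at h1
    exact zero_ne_one h1
  obtain ⟨K, _, _, _, π, Ω, hπ0, hπ⟩ := exists_representation_of_states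
    (B := fun N => SymPow H N →L[ℂ] SymPow H N)
    (fun N => expectation _ (hsum N).summable) (fun N => norm_expectation_le (hsum N))
    (fun N => expectation_star_mul_self_nonneg _ _)
  let T : H → H → (K →L[ℂ] K) := fun f g => π (oneBodySeq f g)
  have hTstar : ∀ f g, star (T f g) = T g f := by
    intro f g
    change star (π _) = π _
    rw [← map_star]
    congr 1
    ext1
    funext N
    exact adjoint_oneBody f g N
  have hTcomm : ∀ f g f' g', T f g * T f' g' = T f' g' * T f g := by
    intro f g f' g'
    change π _ * π _ = π _ * π _
    rw [← sub_eq_zero, ← map_mul, ← map_mul, ← map_sub]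
    exact hπ0 _ (tendsto_zero_of_norm_succ_le (fun N => norm_nonneg _) fun N =>
      norm_oneBody_commutator_le N f g f' g')
  have hTex : ∀ f g f' g', T f g * T f' g' = T f g' * T f' g := by
    intro f g f' g'
    change π _ * π _ = π _ * π _
    rw [← sub_eq_zero, ← map_mul, ← map_mul, ← map_sub]
    exact hπ0 _ (tendsto_zero_of_norm_succ_le (fun N => norm_nonneg _) fun N =>
      norm_oneBody_mul_sub_exchange_le N f g f' g')
  have hΩ : ⟪Ω, Ω⟫_ℂ = 1 := by
    have := hπ 1 1 (tendsto_const_nhds.congr fun N => (expectation_one (hsum N)).symm)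
    rwa [map_one] at this
  let ω : (K →L[ℂ] K) →ₗ[ℂ] ℂ :=
    ((innerSL ℂ Ω) ∘L (ContinuousLinearMap.apply ℂ K Ω)).toLinearMap
  have hω : ∀ A, ω A = ⟪Ω, A Ω⟫_ℂ := fun A => rfl
  obtain ⟨X, iX1, iX2, iX3, iX4, ν, iν, ev, hev, hint⟩ := exists_gelfand_model
    (Set.range fun p : H × H => T p.1 p.2)
    (by rintro _ ⟨p, rfl⟩ _ ⟨q, rfl⟩; exact hTcomm _ _ _ _)
    (by rintro _ ⟨p, rfl⟩; exact ⟨(p.2, p.1), (hTstar _ _).symm⟩) ω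
    (fun A => by
      rw [hω, mul_apply_eq_comp, ContinuousLinearMap.star_eq_adjoint,
        ContinuousLinearMap.adjoint_inner_right, inner_self_eq_norm_sq_to_K, ← RCLike.ofReal_pow]
      exact Complex.zero_le_real.mpr (sq_nonneg _))
    (by rw [hω]; exact hΩ)
  let ζ : H → H →
      (StarAlgebra.adjoin ℂ (Set.range fun p : H × H => T p.1 p.2)).topologicalClosure :=
    fun f g => ⟨T f g, StarSubalgebra.le_topologicalClosure _
      (StarAlgebra.subset_adjoin ℂ _ ⟨(f, g), rfl⟩)⟩
  have hπn : ∀ a, ‖π a‖ ≤ ‖a‖ := fun a => NonUnitalStarAlgHom.norm_apply_le π a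
  refine ⟨X, iX1, iX2, iX3, iX4, ν, iν, fun f g => ev (ζ f g), fun f f' g => ?_,
    fun c f g => ?_, fun f g => ?_, fun f g f' g' => ?_, fun f g x => ?_, fun f x => ?_,
    fun k f g => ?_⟩
  · change ev _ = ev _ + ev _
    rw [← map_add]
    refine congrArg ev (Subtype.ext ?_)
    change π _ = π _ + π _
    rw [← map_add]
    congr 1
    ext1
    funext N
    exact oneBody_add f f' g N
  · change ev _ = c • ev _
    rw [← map_smul]
    refine congrArg ev (Subtype.ext ?_)
    change π _ = c • π _
    rw [← map_smul]
    congr 1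
    ext1
    funext N
    exact oneBody_smul c f g N
  · rw [← map_star]
    congr 1
    exact Subtype.ext (hTstar f g)
  · rw [← map_mul, ← map_mul]
    congr 1
    exact Subtype.ext (hTex f g f' g')
  · refine (hev _ x).trans ((hπn _).trans ?_)
    exact lp.norm_le_of_forall_le (by positivity) fun N => norm_oneBody_le f g N
  · have h1 : ((‖f‖ ^ 2 : ℝ) : ℂ) - ev (ζ f f) x
        = ev (((‖f‖ ^ 2 : ℝ) : ℂ) • 1 - ζ f f) x := by
      rw [map_sub, map_smul, map_one]
      simp
    rw [h1]
    refine (hev _ x).trans ?_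
    change ‖((‖f‖ ^ 2 : ℝ) : ℂ) • (1 : K →L[ℂ] K) - π _‖ ≤ _
    rw [← map_one π, ← map_smul, ← map_sub]
    refine (hπn _).trans (lp.norm_le_of_forall_le (by positivity) fun N => ?_)
    exact norm_smul_one_sub_oneBody_le f N
  · have h1 := hint (ζ f g ^ k)
    rw [map_pow] at h1
    refine h1.symm.trans ?_
    change ⟪Ω, (π (oneBodySeq f g) ^ k : K →L[ℂ] K) Ω⟫_ℂ = _
    rw [← map_pow]
    refine hπ _ _ ?_
    refine (tendsto_expectation_oneBody_pow hS hSS hsum (hconv k) f g).congr fun N => ?_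
    rw [lp.infty_coeFn_pow, Pi.pow_apply, oneBodySeq_apply]

end Model

/-! ### Measurable selection of vectors -/

section Selection

variable {H : Type*} [NormedAddCommGroup H] [InnerProductSpace ℂ H]

/-- Orthonormal vectors are `√2` apart, so the balls of radius `1/2` around them are disjoint open
sets. -/
theorem countable_of_orthonormal [TopologicalSpace.SeparableSpace H] {ι : Type*} {v : ι → H}
    (hv : Orthonormal ℂ v) : Countable ι := by
  refine Pairwise.countable_of_isOpen_disjoint (s := fun i => Metric.ball (v i) (1 / 2))
    (fun i j hij => ?_) (fun i => Metric.isOpen_ball)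
    fun i => ⟨v i, Metric.mem_ball_self (by norm_num)⟩
  refine Metric.ball_disjoint_ball ?_
  rw [dist_eq_norm]
  have h := norm_sub_sq (𝕜 := ℂ) (v i) (v j)
  rw [hv.2 hij, hv.1 i, hv.1 j] at h
  simp only [map_zero] at h
  nlinarith [norm_nonneg (v i - v j)]

variable [CompleteSpace H] [TopologicalSpace.SeparableSpace H] [MeasurableSpace H] [BorelSpace H]

theorem measurable_of_inner {X : Type*} [MeasurableSpace X] {u : X → H}
    (h : ∀ g, Measurable fun x => ⟪g, u x⟫_ℂ) : Measurable u := by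
  have := UniformSpace.secondCountable_of_separable H
  have : Countable (basisIndex H) := countable_of_orthonormal (someBasis H).orthonormal
  refine measurable_of_tendsto_metrizable' (atTop : Filter (Finset (basisIndex H)))
    (f := fun s x => ∑ i ∈ s, ⟪someBasis H i, u x⟫_ℂ • someBasis H i) (fun s => ?_) ?_
  · exact Finset.measurable_fun_sum s fun i _ => (h _).smul_const _
  · rw [tendsto_pi_nhds]
    intro x
    have := (someBasis H).hasSum_repr (u x)
    simpa only [HilbertBasis.repr_apply_apply, HasSum, SummationFilter.unconditional_filter]
      using this

/-- A measurable family of bounded sesquilinear forms of rank at most one is given by a measurable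
family of vectors. -/
theorem exists_measurable_vector {X : Type*} [MeasurableSpace X] (z : X → H → H → ℂ)
    (hm : ∀ f g, Measurable fun x => z x f g)
    (hadd : ∀ x f f' g, z x (f + f') g = z x f g + z x f' g)
    (hsmul : ∀ x (c : ℂ) f g, z x (c • f) g = c * z x f g)
    (hstar : ∀ x f g, conj (z x f g) = z x g f)
    (hex : ∀ x f g f' g', z x f g * z x f' g' = z x f g' * z x f' g)
    (hn : ∀ x f g, ‖z x f g‖ ≤ ‖f‖ * ‖g‖)
    (hpos : ∀ x f, ‖((‖f‖ ^ 2 : ℝ) : ℂ) - z x f f‖ ≤ ‖f‖ ^ 2) :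
    ∃ u : X → H, Measurable u ∧ (∀ x, ‖u x‖ ≤ 1) ∧ ∀ x f g, z x f g = ⟪g, u x⟫_ℂ * ⟪u x, f⟫_ℂ := by
  classical
  have := UniformSpace.secondCountable_of_separable H
  let L : X → H → (H →L[ℂ] ℂ) := fun x g => LinearMap.mkContinuous
    { toFun := fun f => z x f g
      map_add' := fun f f' => hadd x f f' g
      map_smul' := fun c f => hsmul x c f g } ‖g‖ fun f => (hn x f g).trans (mul_comm _ _).le
  have hL : ∀ x g f, L x g f = z x f g := fun x g f => rfl
  let d : ℕ → H := TopologicalSpace.denseSeq H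
  have hd : DenseRange d := TopologicalSpace.denseRange_denseSeq H
  let r : ℕ → X → ℝ := fun n x => (z x (d n) (d n)).re
  have hr : ∀ n x, z x (d n) (d n) = (r n x : ℂ) := fun n x =>
    (Complex.conj_eq_iff_re.mp (hstar x _ _)).symm
  have hr0 : ∀ n x, 0 ≤ r n x := by
    intro n x
    have h := hpos x (d n)
    rw [hr, ← Complex.ofReal_sub, Complex.norm_real, Real.norm_eq_abs] at h
    linarith [le_abs_self (‖d n‖ ^ 2 - r n x)]
  -- If `z x f g = ⟨g,u⟩⟨u,f⟩`, the Riesz vector of `f ↦ z x f (d n)` is `⟨u, d n⟩ u` and `r n x =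
  -- |⟨d n, u⟩|²`. The quotient is therefore `u` up to a phase whenever `r n x ≠ 0`.
  let w : ℕ → X → H := fun n x =>
    (((Real.sqrt (r n x))⁻¹ : ℝ) : ℂ) • (InnerProductSpace.toDual ℂ H).symm (L x (d n))
  have hwi : ∀ n x f, ⟪w n x, f⟫_ℂ = (((Real.sqrt (r n x))⁻¹ : ℝ) : ℂ) * z x f (d n) := by
    intro n x f
    rw [inner_smul_left, Complex.conj_ofReal, InnerProductSpace.toDual_symm_apply, hL]
  have hwi' : ∀ n x g, ⟪g, w n x⟫_ℂ = (((Real.sqrt (r n x))⁻¹ : ℝ) : ℂ) * z x (d n) g := by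
    intro n x g
    rw [← inner_conj_symm, hwi, map_mul, Complex.conj_ofReal, hstar]
  have hrm : ∀ n, Measurable (r n) := fun n => Complex.measurable_re.comp (hm _ _)
  have hwm : ∀ n, Measurable (w n) := by
    intro n
    refine measurable_of_inner fun g => ?_
    simp only [hwi']
    exact (Complex.measurable_ofReal.comp (hrm n).sqrt.inv).mul (hm _ _)
  -- Taking the first admissible index makes the choice of vector measurable; the second alternative
  -- covers the points where the form vanishes.
  let p : ℕ → X → Prop := fun n x => r n x ≠ 0 ∨ ∀ m, r m x = 0
  have hp : ∀ x, ∃ n, p n x := by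
    intro x
    by_cases h : ∀ m, r m x = 0
    · exact ⟨0, Or.inr h⟩
    · push Not at h
      obtain ⟨n, hn⟩ := h
      exact ⟨n, Or.inl hn⟩
  have hpm : ∀ n, MeasurableSet {x | p n x} := by
    intro n
    refine MeasurableSet.union ((hrm n) (measurableSet_singleton 0)).compl ?_
    have : {x | ∀ m, r m x = 0} = ⋂ m, {x | r m x = 0} := by ext; simp
    change MeasurableSet {x | ∀ m, r m x = 0}
    rw [this]
    exact MeasurableSet.iInter fun m => hrm m (measurableSet_singleton 0)
  have key : ∀ x f g, z x f g
      = ⟪g, w (Nat.find (hp x)) x⟫_ℂ * ⟪w (Nat.find (hp x)) x, f⟫_ℂ := by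
    intro x f g
    set n := Nat.find (hp x) with hn_def
    rw [hwi, hwi']
    rcases Nat.find_spec (hp x) with h | h
    · rw [← hn_def] at h
      have h1 : ((Real.sqrt (r n x) : ℝ) : ℂ) * ((Real.sqrt (r n x) : ℝ) : ℂ) = (r n x : ℂ) := by
        exact_mod_cast Real.mul_self_sqrt (hr0 n x)
      have h2 : ((Real.sqrt (r n x) : ℝ) : ℂ) ≠ 0 := by
        intro h0
        rw [h0, zero_mul] at h1
        exact h (by exact_mod_cast h1.symm)
      have h3 := hex x f g (d n) (d n)
      rw [hr, ← h1] at h3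
      rw [Complex.ofReal_inv]
      field_simp
      linear_combination h3
    -- The exchange relation gives `|z (d m) g|² = z (d m) (d m) * z g g = 0`, and density then
    -- makes the whole form zero.
    · have h4 : ∀ m, z x (d m) g = 0 := by
        intro m
        have h5 := hex x (d m) g g (d m)
        rw [hr m, h m, Complex.ofReal_zero, zero_mul, ← hstar x (d m) g, Complex.mul_conj] at h5
        exact Complex.normSq_eq_zero.mp (by exact_mod_cast h5)
      have h6 : (L x g : H → ℂ) = fun _ => 0 :=
        hd.equalizer (L x g).continuous continuous_const (funext fun m => h4 m)
      rw [h4, ← hL, h6]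
      simp
  refine ⟨fun x => w (Nat.find (hp x)) x, Measurable.find hwm hpm hp, fun x => ?_, key⟩
  -- With both arguments equal to `v`, the bound reads `‖v‖⁴ ≤ ‖v‖²`.
  have h1 := hn x (w (Nat.find (hp x)) x) (w (Nat.find (hp x)) x)
  rw [key x, norm_mul] at h1
  set v := w (Nat.find (hp x)) x
  rw [inner_self_eq_norm_sq_to_K] at h1
  have h2 : ‖((‖v‖ : ℂ)) ^ 2‖ = ‖v‖ ^ 2 := by
    rw [norm_pow, Complex.norm_real, norm_norm]
  erw [h2] at h1
  by_contra h3
  push Not at h3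
  have h4 : 1 < ‖v‖ ^ 2 := one_lt_pow₀ h3 two_ne_zero
  nlinarith

end Selection

/-! ### Averaging over the phase -/

section Averaging

variable {H : Type*} [NormedAddCommGroup H] [InnerProductSpace ℂ H]

theorem inner_mul_inner_sphere_smul (s : Metric.sphere (0 : ℂ) 1)
    (u : Metric.closedBall (0 : H) 1) (f g : H) :
    ⟪g, ((s • u : Metric.closedBall (0 : H) 1) : H)⟫_ℂ
        * ⟪((s • u : Metric.closedBall (0 : H) 1) : H), f⟫_ℂ
      = ⟪g, (u : H)⟫_ℂ * ⟪(u : H), f⟫_ℂ := by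
  have h : ((s • u : Metric.closedBall (0 : H) 1) : H) = (s : ℂ) • (u : H) := rfl
  have hs : (s : ℂ) * conj (s : ℂ) = 1 := by
    rw [Complex.mul_conj', mem_sphere_zero_iff_norm.mp s.2]
    simp
  rw [h, inner_smul_left, inner_smul_right]
  linear_combination (⟪g, (u : H)⟫_ℂ * ⟪(u : H), f⟫_ℂ) * hs

variable [TopologicalSpace.SeparableSpace H] [MeasurableSpace H] [BorelSpace H]

/-- Averaging a measure on the unit ball over the phase does not change the integrals of gauge
invariant functions. -/
theorem exists_phase_average (μ₀ : Measure (Metric.closedBall (0 : H) 1))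
    [IsProbabilityMeasure μ₀] :
    ∃ μ : ProbabilityMeasure (Metric.closedBall (0 : H) 1),
      (∀ z : Metric.sphere (0 : ℂ) 1,
        (μ : Measure (Metric.closedBall (0 : H) 1)).map (fun u => z • u) = μ) ∧
      ∀ F : Metric.closedBall (0 : H) 1 → ℂ, Continuous F →
        (∀ (z : Metric.sphere (0 : ℂ) 1) u, F (z • u) = F u) →
        ∫ u, F u ∂(μ : Measure (Metric.closedBall (0 : H) 1)) = ∫ u, F u ∂μ₀ := by
  have := UniformSpace.secondCountable_of_separable H
  let K : TopologicalSpace.PositiveCompacts (Metric.sphere (0 : ℂ) 1) := ⊤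
  let m : Measure (Metric.sphere (0 : ℂ) 1) := Measure.haarMeasure K
  have hm : IsProbabilityMeasure m := ⟨by
    have := Measure.haarMeasure_self (K₀ := K)
    exact this⟩
  let a : Metric.sphere (0 : ℂ) 1 × Metric.closedBall (0 : H) 1 → Metric.closedBall (0 : H) 1 :=
    fun p => p.1 • p.2
  have hac : Continuous a := continuous_smul
  have ha : Measurable a := hac.measurable
  have hprob : IsProbabilityMeasure ((m.prod μ₀).map a) :=
    Measure.isProbabilityMeasure_map ha.aemeasurable
  refine ⟨⟨(m.prod μ₀).map a, hprob⟩, fun z => ?_, fun F hF hinv => ?_⟩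
  · have hz : Measurable fun u : Metric.closedBall (0 : H) 1 => z • u :=
      (continuous_const_smul z).measurable
    -- A rotation by `z` is absorbed by translation invariance of Haar measure on the circle.
    have hmp := (measurePreserving_mul_left m z).prod (MeasurePreserving.id μ₀)
    change ((m.prod μ₀).map a).map (fun u => z • u) = (m.prod μ₀).map a
    rw [Measure.map_map hz ha]
    nth_rewrite 2 [← hmp.map_eq]
    rw [Measure.map_map ha hmp.measurable]
    congr 1
    funext p
    exact (mul_smul z p.1 p.2).symm
  · change ∫ u, F u ∂((m.prod μ₀).map a) = _
    rw [integral_map ha.aemeasurable hF.aestronglyMeasurable]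
    have : ∀ p, F (a p) = F p.2 := fun p => hinv p.1 p.2
    simp only [this]
    have hsnd := measurePreserving_snd (μ := m) (ν := μ₀)
    nth_rewrite 2 [← hsnd.map_eq]
    rw [integral_map hsnd.measurable.aemeasurable hF.aestronglyMeasurable]

end Averaging

/-! ### Moments of measures on the unit ball -/

section Moments

theorem integrable_of_continuous_of_norm_le {H E : Type*} [NormedAddCommGroup H]
    [TopologicalSpace.SeparableSpace H] [MeasurableSpace H] [BorelSpace H] [NormedAddCommGroup E]
    (μ : Measure (Metric.closedBall (0 : H) 1)) [IsFiniteMeasure μ]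
    {F : Metric.closedBall (0 : H) 1 → E} (hF : Continuous F) {C : ℝ} (hC : ∀ u, ‖F u‖ ≤ C) :
    Integrable F μ := by
  have := UniformSpace.secondCountable_of_separable H
  exact Integrable.of_bound hF.aestronglyMeasurable C (Eventually.of_forall hC)

theorem norm_coe_closedBall_le {H : Type*} [NormedAddCommGroup H]
    (u : Metric.closedBall (0 : H) 1) : ‖(u : H)‖ ≤ 1 :=
  mem_closedBall_zero_iff.mp u.2

variable {H : Type*} [NormedAddCommGroup H] [InnerProductSpace ℂ H]

theorem norm_inner_closedBall_le (g : H) (u : Metric.closedBall (0 : H) 1) :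
    ‖⟪g, (u : H)⟫_ℂ‖ ≤ ‖g‖ :=
  (norm_inner_le_norm _ _).trans
    (mul_le_of_le_one_right (norm_nonneg _) (norm_coe_closedBall_le u))

variable [TopologicalSpace.SeparableSpace H] [MeasurableSpace H] [BorelSpace H]

theorem integrable_rankOne_powTensor (μ : Measure (Metric.closedBall (0 : H) 1))
    [IsFiniteMeasure μ] (k : ℕ) :
    Integrable (fun u : Metric.closedBall (0 : H) 1 =>
      InnerProductSpace.rankOne ℂ (powTensor (u : H) k) (powTensor (u : H) k)) μ := by
  refine integrable_of_continuous_of_norm_le (C := 1) μ ?_ fun u => ?_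
  · have hc : Continuous fun u : Metric.closedBall (0 : H) 1 => powTensor (u : H) k :=
      continuous_powTensor.comp continuous_subtype_val
    exact ((ContinuousLinearMap.smulRightL ℂ (SymPow H k) (SymPow H k)).continuous.comp
      ((innerSL ℂ).continuous.comp hc)).clm_apply hc
  · rw [InnerProductSpace.norm_rankOne, norm_powTensor]
    have h := pow_le_one₀ (n := k) (norm_nonneg _) (norm_coe_closedBall_le u)
    exact mul_le_one₀ h (by positivity) h

theorem inner_integral_rankOne_powTensor (μ : Measure (Metric.closedBall (0 : H) 1))
    [IsFiniteMeasure μ] (k : ℕ) (f g : H) :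
    ⟪powTensor g k, (∫ u : Metric.closedBall (0 : H) 1,
        InnerProductSpace.rankOne ℂ (powTensor (u : H) k) (powTensor (u : H) k) ∂μ)
        (powTensor f k)⟫_ℂ
      = ∫ u : Metric.closedBall (0 : H) 1, (⟪g, (u : H)⟫_ℂ * ⟪(u : H), f⟫_ℂ) ^ k ∂μ := by
  have h := ContinuousLinearMap.integral_comp_comm ((innerSL ℂ (powTensor g k)) ∘L
    (ContinuousLinearMap.apply ℂ (SymPow H k) (powTensor f k))) (integrable_rankOne_powTensor μ k)
  refine h.symm.trans (integral_congr_ae (Eventually.of_forall fun u => ?_))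
  simp only [ContinuousLinearMap.comp_apply, ContinuousLinearMap.apply_apply, innerSL_apply_apply,
    InnerProductSpace.rankOne_apply, inner_smul_right, inner_powTensor]
  rw [mul_pow, mul_comm]

/-! ### Uniqueness -/

theorem integral_pow_mul_conj_pow_eq_zero (μ : Measure (Metric.closedBall (0 : H) 1))
    (hμ : ∀ z : Metric.sphere (0 : ℂ) 1, μ.map (fun u => z • u) = μ) (g : H) {j l : ℕ}
    (hjl : j ≠ l) :
    ∫ u : Metric.closedBall (0 : H) 1, ⟪g, (u : H)⟫_ℂ ^ j * conj ⟪g, (u : H)⟫_ℂ ^ l ∂μ = 0 := by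
  have := UniformSpace.secondCountable_of_separable H
  have hd : (j : ℝ) - l ≠ 0 := sub_ne_zero.mpr (by exact_mod_cast hjl)
  -- The rotation by `θ` multiplies the integrand by `e^{i(j-l)θ} = -1`, so by invariance the
  -- integral equals its own negative.
  set θ : ℝ := Real.pi / (j - l) with hθ
  let z : Metric.sphere (0 : ℂ) 1 := ⟨Complex.exp (θ * Complex.I), by
    rw [mem_sphere_zero_iff_norm, Complex.norm_exp_ofReal_mul_I]⟩
  have hz : (z : ℂ) ^ j * conj (z : ℂ) ^ l = -1 := by
    change Complex.exp (θ * Complex.I) ^ j * conj (Complex.exp (θ * Complex.I)) ^ l = -1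
    rw [← Complex.exp_conj, map_mul, Complex.conj_ofReal, Complex.conj_I, ← Complex.exp_nat_mul,
      ← Complex.exp_nat_mul, ← Complex.exp_add, ← Complex.exp_pi_mul_I]
    congr 1
    have h1 : ((j : ℂ) - l) * θ = Real.pi := by
      have : ((j : ℝ) - l) * θ = Real.pi := by rw [hθ]; field_simp
      exact_mod_cast this
    linear_combination Complex.I * h1
  set F : Metric.closedBall (0 : H) 1 → ℂ :=
    fun u => ⟪g, (u : H)⟫_ℂ ^ j * conj ⟪g, (u : H)⟫_ℂ ^ l with hF
  have hFc : Continuous F := by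
    have h1 : Continuous fun u : Metric.closedBall (0 : H) 1 => ⟪g, (u : H)⟫_ℂ :=
      continuous_const.inner continuous_subtype_val
    exact (h1.pow j).mul ((Complex.continuous_conj.comp h1).pow l)
  have hFz : ∀ u, F (z • u) = -F u := by
    intro u
    have h : ((z • u : Metric.closedBall (0 : H) 1) : H) = (z : ℂ) • (u : H) := rfl
    simp only [hF, h, inner_smul_right, map_mul, mul_pow]
    linear_combination (⟪g, (u : H)⟫_ℂ ^ j * conj ⟪g, (u : H)⟫_ℂ ^ l) * hz
  have h1 : ∫ u, F u ∂μ = -∫ u, F u ∂μ := by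
    conv_lhs => rw [← hμ z]
    rw [integral_map (continuous_const_smul z).measurable.aemeasurable hFc.aestronglyMeasurable,
      ← integral_neg]
    simp only [hFz]
  exact self_eq_neg.mp h1

/-- In the binomial expansion, phase invariance kills the terms of unequal degrees, and the others
are the moments in the hypothesis. -/
theorem integral_add_conj_pow_eq (μ ν : Measure (Metric.closedBall (0 : H) 1))
    [IsFiniteMeasure μ] [IsFiniteMeasure ν]
    (hμ : ∀ z : Metric.sphere (0 : ℂ) 1, μ.map (fun u => z • u) = μ)
    (hν : ∀ z : Metric.sphere (0 : ℂ) 1, ν.map (fun u => z • u) = ν) (g : H)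
    (h : ∀ k : ℕ, ∫ u : Metric.closedBall (0 : H) 1, (⟪g, (u : H)⟫_ℂ * ⟪(u : H), g⟫_ℂ) ^ k ∂μ
      = ∫ u : Metric.closedBall (0 : H) 1, (⟪g, (u : H)⟫_ℂ * ⟪(u : H), g⟫_ℂ) ^ k ∂ν) (n : ℕ) :
    ∫ u : Metric.closedBall (0 : H) 1, (⟪g, (u : H)⟫_ℂ + conj ⟪g, (u : H)⟫_ℂ) ^ n ∂μ
      = ∫ u : Metric.closedBall (0 : H) 1, (⟪g, (u : H)⟫_ℂ + conj ⟪g, (u : H)⟫_ℂ) ^ n ∂ν := by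
  have h1 : Continuous fun u : Metric.closedBall (0 : H) 1 => ⟪g, (u : H)⟫_ℂ :=
    continuous_const.inner continuous_subtype_val
  have hint : ∀ (ρ : Measure (Metric.closedBall (0 : H) 1)) [IsFiniteMeasure ρ] (j l : ℕ),
      Integrable (fun u : Metric.closedBall (0 : H) 1 =>
        ⟪g, (u : H)⟫_ℂ ^ j * conj ⟪g, (u : H)⟫_ℂ ^ l) ρ := by
    intro ρ _ j l
    refine integrable_of_continuous_of_norm_le ρ
      ((h1.pow j).mul ((Complex.continuous_conj.comp h1).pow l)) (C := ‖g‖ ^ j * ‖g‖ ^ l)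
      fun u => ?_
    rw [norm_mul, norm_pow, norm_pow, RCLike.norm_conj]
    have := norm_inner_closedBall_le g u
    gcongr
  have heq : ∀ j l : ℕ, ∫ u : Metric.closedBall (0 : H) 1,
      ⟪g, (u : H)⟫_ℂ ^ j * conj ⟪g, (u : H)⟫_ℂ ^ l ∂μ
      = ∫ u : Metric.closedBall (0 : H) 1, ⟪g, (u : H)⟫_ℂ ^ j * conj ⟪g, (u : H)⟫_ℂ ^ l ∂ν := by
    intro j l
    by_cases hjl : j = l
    · subst hjl
      simpa only [inner_conj_symm, ← mul_pow] using h j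
    · rw [integral_pow_mul_conj_pow_eq_zero μ hμ g hjl,
        integral_pow_mul_conj_pow_eq_zero ν hν g hjl]
  simp only [add_pow]
  rw [integral_finsetSum _ fun j _ => (hint μ _ _).mul_const _,
    integral_finsetSum _ fun j _ => (hint ν _ _).mul_const _]
  refine Finset.sum_congr rfl fun j _ => ?_
  rw [integral_mul_const, integral_mul_const, heq]

/-- The exponential series of `i Re⟨g,u⟩`, with `Re⟨g,u⟩` written as half the sum with the conjugate
(hence `I / 2`). On the unit ball the terms are dominated by `‖g‖ⁿ / n!`, which permits termwise
integration. -/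
theorem hasSum_integral_exp_re_inner (μ : Measure (Metric.closedBall (0 : H) 1))
    [IsProbabilityMeasure μ] (g : H) :
    HasSum (fun n : ℕ => (Complex.I / 2) ^ n / (n.factorial : ℂ) *
        ∫ u : Metric.closedBall (0 : H) 1, (⟪g, (u : H)⟫_ℂ + conj ⟪g, (u : H)⟫_ℂ) ^ n ∂μ)
      (∫ u : Metric.closedBall (0 : H) 1,
        Complex.exp (((⟪g, (u : H)⟫_ℂ).re : ℂ) * Complex.I) ∂μ) := by
  let F : ℕ → Metric.closedBall (0 : H) 1 → ℂ := fun n u =>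
    (Complex.I / 2) ^ n / (n.factorial : ℂ) * (⟪g, (u : H)⟫_ℂ + conj ⟪g, (u : H)⟫_ℂ) ^ n
  have h1 : Continuous fun u : Metric.closedBall (0 : H) 1 => ⟪g, (u : H)⟫_ℂ :=
    continuous_const.inner continuous_subtype_val
  have hbd : ∀ n u, ‖F n u‖ ≤ ‖g‖ ^ n / n.factorial := by
    intro n u
    have h2 : ‖⟪g, (u : H)⟫_ℂ + conj ⟪g, (u : H)⟫_ℂ‖ ≤ 2 * ‖g‖ := by
      refine (norm_add_le _ _).trans ?_
      rw [RCLike.norm_conj]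
      linarith [norm_inner_closedBall_le g u]
    have h3 := pow_le_pow_left₀ (norm_nonneg _) h2 n
    simp only [F, norm_mul, norm_div, norm_pow, Complex.norm_I, Complex.norm_natCast,
      Complex.norm_ofNat]
    calc _ ≤ (1 / 2) ^ n / (n.factorial : ℝ) * (2 * ‖g‖) ^ n := by gcongr
      _ = ‖g‖ ^ n / n.factorial := by
        rw [div_mul_eq_mul_div, ← mul_pow]
        congr 2
        ring
  have hint : ∀ n, Integrable (F n) μ := fun n =>
    integrable_of_continuous_of_norm_le μ
      (continuous_const.mul ((h1.add (Complex.continuous_conj.comp h1)).pow n)) (hbd n)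
  have hsum : Summable fun n => ∫ u, ‖F n u‖ ∂μ := by
    refine Summable.of_nonneg_of_le (fun n => integral_nonneg fun u => norm_nonneg _)
      (fun n => ?_) (Real.summable_pow_div_factorial ‖g‖)
    refine (integral_mono (hint n).norm (integrable_const _) (hbd n)).trans (le_of_eq ?_)
    simp
  have h := hasSum_integral_of_summable_integral_norm hint hsum
  simp only [F, integral_const_mul] at h
  have hexp : ∀ u : Metric.closedBall (0 : H) 1,
      Complex.exp (((⟪g, (u : H)⟫_ℂ).re : ℂ) * Complex.I)
        = ∑' n : ℕ, (Complex.I / 2) ^ n / (n.factorial : ℂ)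
          * (⟪g, (u : H)⟫_ℂ + conj ⟪g, (u : H)⟫_ℂ) ^ n := by
    intro u
    rw [Complex.exp_eq_exp_ℂ, NormedSpace.exp_eq_tsum_div]
    refine tsum_congr fun n => ?_
    rw [Complex.re_eq_add_conj, div_mul_eq_mul_div _ _ ((_ : ℂ) ^ n), ← mul_pow]
    congr 2
    ring
  simpa only [hexp] using h

variable [CompleteSpace H]

/-- Gauge invariant probability measures on the unit ball are determined by their moments. -/
theorem eq_of_moments_eq (μ ν : ProbabilityMeasure (Metric.closedBall (0 : H) 1))
    (hμ : ∀ z : Metric.sphere (0 : ℂ) 1,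
      (μ : Measure (Metric.closedBall (0 : H) 1)).map (fun u => z • u) = μ)
    (hν : ∀ z : Metric.sphere (0 : ℂ) 1,
      (ν : Measure (Metric.closedBall (0 : H) 1)).map (fun u => z • u) = ν)
    (h : ∀ (k : ℕ) (g : H),
      ∫ u : Metric.closedBall (0 : H) 1, (⟪g, (u : H)⟫_ℂ * ⟪(u : H), g⟫_ℂ) ^ k
        ∂(μ : Measure (Metric.closedBall (0 : H) 1))
      = ∫ u : Metric.closedBall (0 : H) 1, (⟪g, (u : H)⟫_ℂ * ⟪(u : H), g⟫_ℂ) ^ k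
        ∂(ν : Measure (Metric.closedBall (0 : H) 1))) : μ = ν := by
  have := UniformSpace.secondCountable_of_separable H
  have hm : Measurable (Subtype.val : Metric.closedBall (0 : H) 1 → H) := measurable_subtype_coe
  have hemb : MeasurableEmbedding (Subtype.val : Metric.closedBall (0 : H) 1 → H) :=
    MeasurableEmbedding.subtype_coe Metric.isClosed_closedBall.measurableSet
  -- The comparison is moved from the ball to `H`, a separable Banach space, where characteristic
  -- functions determine finite measures.
  refine Subtype.ext (hemb.map_injective ?_)
  change (μ : Measure (Metric.closedBall (0 : H) 1)).map Subtype.val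
    = (ν : Measure (Metric.closedBall (0 : H) 1)).map Subtype.val
  have := Measure.isProbabilityMeasure_map
    (μ := (μ : Measure (Metric.closedBall (0 : H) 1))) hm.aemeasurable
  have := Measure.isProbabilityMeasure_map
    (μ := (ν : Measure (Metric.closedBall (0 : H) 1))) hm.aemeasurable
  refine Measure.ext_of_charFunDual (funext fun L => ?_)
  -- Every real functional is the real part of a complex one, so Riesz representation applies.
  obtain ⟨g, hg⟩ : ∃ g : H, ∀ u, L u = (⟪g, u⟫_ℂ).re := by
    refine ⟨(InnerProductSpace.toDual ℂ H).symm (L.extendRCLike (𝕜 := ℂ)), fun u => ?_⟩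
    rw [InnerProductSpace.toDual_symm_apply]
    exact (StrongDual.re_extendRCLike_apply (𝕜 := ℂ) L u).symm
  rw [charFunDual_apply, charFunDual_apply, integral_map hm.aemeasurable (by fun_prop),
    integral_map hm.aemeasurable (by fun_prop)]
  simp only [hg]
  refine (hasSum_integral_exp_re_inner (μ : Measure (Metric.closedBall (0 : H) 1)) g).unique ?_
  have h2 := hasSum_integral_exp_re_inner (ν : Measure (Metric.closedBall (0 : H) 1)) g
  simpa only [integral_add_conj_pow_eq _ _ hμ hν g fun k => h k g] using h2

end Moments

end DeFinetti

/-! ### The weak quantum de Finetti theorem -/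

theorem mainTheorem2 {H : Type*} [NormedAddCommGroup H] [InnerProductSpace ℂ H] [CompleteSpace H]
    [TopologicalSpace.SeparableSpace H] [MeasurableSpace H] [BorelSpace H]
    (Γ : ∀ N : ℕ, DeFinetti.SymPow H N →L[ℂ] DeFinetti.SymPow H N)
    (hΓ : ∀ N, DeFinetti.IsBosonicState (Γ N))
    (γ : ∀ k : ℕ, DeFinetti.SymPow H k →L[ℂ] DeFinetti.SymPow H k)
    (hγ : ∀ k, DeFinetti.IsTraceClass (γ k))
    (hconv : ∀ k : ℕ, DeFinetti.TendstoWeakStar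
      (fun m : ℕ => DeFinetti.reducedDensityMatrix k m (Γ (k + m))) atTop (γ k)) :
    ∃! μ : ProbabilityMeasure (Metric.closedBall (0 : H) 1),
      (∀ z : Metric.sphere (0 : ℂ) 1,
        (μ : Measure (Metric.closedBall (0 : H) 1)).map (fun u => z • u) = μ) ∧
      ∀ k : ℕ,
        Integrable (fun u : Metric.closedBall (0 : H) 1 =>
          InnerProductSpace.rankOne ℂ (DeFinetti.powTensor (u : H) k)
            (DeFinetti.powTensor (u : H) k)) (μ : Measure (Metric.closedBall (0 : H) 1)) ∧
        γ k = ∫ u : Metric.closedBall (0 : H) 1,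
          InnerProductSpace.rankOne ℂ (DeFinetti.powTensor (u : H) k)
            (DeFinetti.powTensor (u : H) k) ∂(μ : Measure (Metric.closedBall (0 : H) 1)) := by
  refine existsUnique_of_exists_of_unique ?_ ?_
  · obtain ⟨X, _, _, _, _, ν, _, Z, hadd, hsmul, hstar, hex, hn, hpos, hint⟩ :=
      DeFinetti.exists_classical_model Γ hΓ γ hconv
    obtain ⟨u, hu, hu1, huz⟩ := DeFinetti.exists_measurable_vector (fun x f g => Z f g x)
      (fun f g => (Z f g).continuous.measurable)
      (fun x f f' g => DFunLike.congr_fun (hadd f f' g) x)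
      (fun x c f g => DFunLike.congr_fun (hsmul c f g) x)
      (fun x f g => DFunLike.congr_fun (hstar f g) x)
      (fun x f g f' g' => DFunLike.congr_fun (hex f g f' g') x)
      (fun x f g => hn f g x) (fun x f => hpos f x)
    have := UniformSpace.secondCountable_of_separable H
    let U : X → Metric.closedBall (0 : H) 1 := fun x => ⟨u x, mem_closedBall_zero_iff.mpr (hu1 x)⟩
    have hU : Measurable U := hu.subtype_mk
    have := Measure.isProbabilityMeasure_map (μ := ν) hU.aemeasurable
    obtain ⟨μ, hμ, hμF⟩ := DeFinetti.exists_phase_average (ν.map U)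
    refine ⟨μ, hμ, fun k => ⟨DeFinetti.integrable_rankOne_powTensor _ k,
      DeFinetti.clm_ext_powTensor fun f g => ?_⟩⟩
    have hc : Continuous fun u : Metric.closedBall (0 : H) 1 =>
        (⟪g, (u : H)⟫_ℂ * ⟪(u : H), f⟫_ℂ) ^ k :=
      ((continuous_const.inner continuous_subtype_val).mul
        (continuous_subtype_val.inner continuous_const)).pow k
    -- The integrand depends on `u` only through `⟨g,u⟩⟨u,f⟩`, so phase averaging leaves the
    -- integral unchanged, and it pulls back to the `k`-th moment of `Z f g`.
    rw [DeFinetti.inner_integral_rankOne_powTensor, hμF _ hc fun z u => by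
      simp only [DeFinetti.inner_mul_inner_sphere_smul], integral_map hU.aemeasurable
      hc.aestronglyMeasurable, ← hint]
    simp only [huz, U]
  · rintro μ ν ⟨hμ, hμγ⟩ ⟨hν, hνγ⟩
    refine DeFinetti.eq_of_moments_eq μ ν hμ hν fun k g => ?_
    rw [← DeFinetti.inner_integral_rankOne_powTensor, ← DeFinetti.inner_integral_rankOne_powTensor,
      ← (hμγ k).2, ← (hνγ k).2]
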